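/- Let $R$ be a finite, commutative, principal, local ring of odd characteristic, with maximal ideal $\mathfrak m=Rx$ of nilpotency degree $\ell\ge 1$ and residue field $R/\mathfrak m$ of order $q$. Let $A=R[t]/(t^2-x)=R\oplus Ry$, $y^2=x$, with the involution $(r+sy)^*=r-sy$. Let $V$ be a free $A$-module of finite rank $m\ge 1$, let $h:V\times V\to A$ be a non-degenerate hermitian form (linear in the second variable, with $h(v,u)=h(u,v)^*$, and with $v\mapsto h(v,-)$ bijective onto the dual of $V$), and let $U$ be its unitary group, consisting of all $A$-linear automorphisms of $V$ preserving $h$. Fix a linear character $\lambda:R^+\to\mathbb C^\times$ whose kernel contains no non-zero ideal of $R$, put $\mu(r+sy)=\lambda(2s)$, and fix a unit $\varepsilon\in R^\times\setminus R^{\times 2}$. For $r_i\in R^\times$, $h$ is said to be of type $\{r_1,\dots,r_m\}$ if it has matrix $\mathrm{diag}(r_1,\dots,r_m)$ relative to some basis of $V$. Let $H=A\times V$ be the Heisenberg group with product $(a,v)(b,w)=(a+b+h(v,w),v+w)$, on which $U$ acts by ${}^g(a,v)=(a,gv)$, and let $V_0=y^\ell V$. Let $X$ be the $H\rtimes U$-module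 induced from the one-dimensional module $\mathbb C\zeta$ of $(A,V_0)\rtimes U$ given by $(a,u)g\,\zeta=\mu(a)\zeta$; as a $U$-module, $X$ is the Weil module of type $\mu$. For $v\in V$ put $e_v=(0,v)\otimes\zeta\in X$, and let $Top$ be the $U$-submodule of $X$ spanned by all $e_v$ with $v\in V\setminus yV$. Then the number of irreducible constituents of the $U$-module $Top$ (which is the same whether counted up to isomorphism or with multiplicity) is equal to the number of $U$-orbits of $V\setminus y^2V$. This number is - $q^\ell-q^{\ell-1}$ if $m=1$; - $2(q^\ell-q^{\ell-1})$ if $m=2$ and $h$ is of type $\{1,-\varepsilon\}$; - $2q^\ell$ otherwise, that is, if $m>2$, or if $m=2$ and $h$ is of type $\{1,-1\}$. -/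

import Mathlib

namespace RamifiedWeil

/-- The ramified extension `A = R[t]/(t² - x) = R ⊕ R y` with `y² = x`. Its elements are pairs
`⟨r, s⟩`, standing for `r + s y`, and Mathlib's `star` on it is the involution
`(r + s y)* = r - s y`. -/
abbrev RamExt {R : Type*} (x : R) [Zero R] : Type _ := QuadraticAlgebra R x 0

/-- The generator `y` of `A` over `R`. -/
abbrev gen {R : Type*} [CommRing R] (x : R) : RamExt x := ⟨0, 1⟩

theorem gen_mul_gen {R : Type*} [CommRing R] (x : R) :
    gen x * gen x = algebraMap R (RamExt x) x := by
  ext <;> simp [gen]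

theorem star_gen {R : Type*} [CommRing R] (x : R) : star (gen x) = -gen x := by
  ext <;> simp [gen]

/-- The `R`-linear map `d : A → R`, `d (r + s y) = 2 s` (as an additive map). -/
def dMap {R : Type*} [CommRing R] (x : R) : RamExt x →+ R where
  toFun a := 2 * a.im
  map_zero' := by simp
  map_add' a b := by simp [mul_add]

/-- The additive character `μ = λ ∘ d` of `A`. -/
noncomputable def muChar {R : Type*} [CommRing R] (x : R) (lam : AddChar R ℂ) :
    AddChar (RamExt x) ℂ :=
  lam.compAddMonoidHom (dMap x)

/-- The submodule `yʲ V` of `V`. -/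
def yPow {R : Type*} [CommRing R] (x : R) (V : Type*) [AddCommGroup V] [Module (RamExt x) V]
    (j : ℕ) : Submodule (RamExt x) V :=
  LinearMap.range (LinearMap.lsmul (RamExt x) V (gen x ^ j))

section Form

variable {R : Type*} [CommRing R] {x : R} {V : Type*} [AddCommGroup V] [Module (RamExt x) V]

/-- `h` is hermitian (it is `*`-linear in the first variable and linear in the second by its
type), and non-degenerate: `v ↦ h(v, -)` is a bijection from `V` onto its dual. -/
structure IsNondegHermitian (h : V →ₗ⋆[RamExt x] V →ₗ[RamExt x] RamExt x) : Prop where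
  symm : ∀ u v : V, h v u = star (h u v)
  nondeg : Function.Bijective (fun v : V => h v)

/-- `h` is of type `{r₁, …, rₙ}`: relative to some basis of `V` the matrix of `h` is
`diag (r₁, …, rₙ)`. -/
def HasType (h : V →ₗ⋆[RamExt x] V →ₗ[RamExt x] RamExt x) {n : ℕ} (r : Fin n → Rˣ) : Prop :=
  ∃ b : Module.Basis (Fin n) (RamExt x) V, ∀ i j : Fin n,
    h (b i) (b j) = if i = j then algebraMap R (RamExt x) (r i : R) else 0

/-- The unitary group `U` of `h`: all `A`-linear automorphisms of `V` preserving `h`. -/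
def unitaryGroup (h : V →ₗ⋆[RamExt x] V →ₗ[RamExt x] RamExt x) :
    Subgroup (V ≃ₗ[RamExt x] V) where
  carrier := {g | ∀ u v : V, h (g u) (g v) = h u v}
  one_mem' := fun _ _ => rfl
  mul_mem' := by
    intro a b ha hb u v
    rw [LinearEquiv.mul_apply, LinearEquiv.mul_apply, ha, hb]
  inv_mem' := by
    intro a ha u v
    rw [← ha (a⁻¹ u) (a⁻¹ v)]
    simp

/-- The Heisenberg group `H(h)`: pairs `(a, v)` with `a ∈ A`, `v ∈ V`, and
`(a, v)(b, w) = (a + b + h(v, w), v + w)`. -/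
@[ext]
structure Heisenberg (h : V →ₗ⋆[RamExt x] V →ₗ[RamExt x] RamExt x) where
  cen : RamExt x
  vec : V

namespace Heisenberg

variable {h : V →ₗ⋆[RamExt x] V →ₗ[RamExt x] RamExt x}

instance : Mul (Heisenberg h) := ⟨fun k l => ⟨k.cen + l.cen + h k.vec l.vec, k.vec + l.vec⟩⟩

instance : One (Heisenberg h) := ⟨⟨0, 0⟩⟩

instance : Inv (Heisenberg h) := ⟨fun k => ⟨-k.cen + h k.vec k.vec, -k.vec⟩⟩

@[simp] theorem mul_cen (k l : Heisenberg h) :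
    (k * l).cen = k.cen + l.cen + h k.vec l.vec := rfl
@[simp] theorem mul_vec (k l : Heisenberg h) : (k * l).vec = k.vec + l.vec := rfl
@[simp] theorem one_cen : (1 : Heisenberg h).cen = 0 := rfl
@[simp] theorem one_vec : (1 : Heisenberg h).vec = 0 := rfl
@[simp] theorem inv_cen (k : Heisenberg h) : (k⁻¹).cen = -k.cen + h k.vec k.vec := rfl
@[simp] theorem inv_vec (k : Heisenberg h) : (k⁻¹).vec = -k.vec := rfl

instance : Group (Heisenberg h) :=
  Group.ofLeftAxioms
    (by
      intro k l n
      apply Heisenberg.ext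
      · simp only [mul_cen, mul_vec, map_add, LinearMap.add_apply]
        abel
      · simp only [mul_vec]
        abel)
    (by intro k; apply Heisenberg.ext <;> simp)
    (by
      intro k
      apply Heisenberg.ext <;> simp)

end Heisenberg

/-- The action of `U` on the Heisenberg group by automorphisms: `ᵍ(a, v) = (a, g v)`. -/
def heisAction (h : V →ₗ⋆[RamExt x] V →ₗ[RamExt x] RamExt x) :
    unitaryGroup h →* MulAut (Heisenberg h) where
  toFun g :=
    { toFun := fun k => ⟨k.cen, (g : V ≃ₗ[RamExt x] V) k.vec⟩
      invFun := fun k => ⟨k.cen, (g : V ≃ₗ[RamExt x] V).symm k.vec⟩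
      left_inv := fun k => by apply Heisenberg.ext <;> simp
      right_inv := fun k => by apply Heisenberg.ext <;> simp
      map_mul' := fun k l => by
        apply Heisenberg.ext
        · simp [g.2 k.vec l.vec]
        · simp }
  map_one' := rfl
  map_mul' _ _ := rfl

/-- The group `H ⋊ U`. -/
abbrev HeisU (h : V →ₗ⋆[RamExt x] V →ₗ[RamExt x] RamExt x) : Type _ :=
  Heisenberg h ⋊[heisAction h] unitaryGroup h

/-- The subgroup `(A, V₀) ⋊ U` of `H ⋊ U`, where `V₀ = y^ℓ V`. -/
def polarSubgroup (h : V →ₗ⋆[RamExt x] V →ₗ[RamExt x] RamExt x) (l : ℕ) :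
    Subgroup (HeisU h) where
  carrier := {k | k.left.vec ∈ yPow x V l}
  one_mem' := (yPow x V l).zero_mem
  mul_mem' := by
    intro a b ha hb
    obtain ⟨w, hw⟩ := hb
    refine (yPow x V l).add_mem ha ⟨(a.right : V ≃ₗ[RamExt x] V) w, ?_⟩
    change _ = (a.right : V ≃ₗ[RamExt x] V) b.left.vec
    rw [← hw]
    simp
  inv_mem' := by
    intro a ha
    obtain ⟨w, hw⟩ := ha
    refine ⟨((a.right⁻¹ : unitaryGroup h) : V ≃ₗ[RamExt x] V) (-w), ?_⟩
    change _ = ((a.right⁻¹ : unitaryGroup h) : V ≃ₗ[RamExt x] V) (-a.left.vec)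
    rw [← hw]
    simp

theorem form_yPow (h : V →ₗ⋆[RamExt x] V →ₗ[RamExt x] RamExt x) {l : ℕ} (hl : x ^ l = 0)
    {u v : V} (hu : u ∈ yPow x V l) (hv : v ∈ yPow x V l) : h u v = 0 := by
  obtain ⟨u, rfl⟩ := hu
  obtain ⟨v, rfl⟩ := hv
  have key : star (gen x ^ l) * gen x ^ l = 0 := by
    rw [star_pow, star_gen, ← mul_pow, neg_mul, gen_mul_gen, neg_pow, ← map_pow, hl]
    simp
  simp only [LinearMap.lsmul_apply, LinearMap.map_smulₛₗ, LinearMap.smul_apply, smul_eq_mul,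
    RingHom.id_apply, starRingEnd_apply]
  rw [← mul_assoc, mul_comm (gen x ^ l), key, zero_mul]

/-- The linear character `(a, u) g ↦ μ(a)` of `(A, V₀) ⋊ U`; it is multiplicative because
`h(V₀, V₀) = 0`, which uses `x^ℓ = 0`. -/
noncomputable def polarChar (h : V →ₗ⋆[RamExt x] V →ₗ[RamExt x] RamExt x) (lam : AddChar R ℂ)
    {l : ℕ} (hl : x ^ l = 0) : polarSubgroup h l →* ℂ where
  toFun k := muChar x lam (k : HeisU h).left.cen
  map_one' := (muChar x lam).map_zero_eq_one
  map_mul' := by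
    rintro ⟨a, ha⟩ ⟨b, hb⟩
    obtain ⟨w, hw⟩ := hb
    have h0 : h a.left.vec ((a.right : V ≃ₗ[RamExt x] V) b.left.vec) = 0 := by
      refine form_yPow h hl ha ⟨(a.right : V ≃ₗ[RamExt x] V) w, ?_⟩
      rw [← hw]
      simp
    change muChar x lam (a.left.cen + b.left.cen +
      h a.left.vec ((a.right : V ≃ₗ[RamExt x] V) b.left.vec)) = _
    rw [h0, add_zero, AddChar.map_add_eq_mul]

/-- The one-dimensional module `Z = ℂ ζ` (with `ζ = 1`) of `(A, V₀) ⋊ U`. -/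
noncomputable def polarRep (h : V →ₗ⋆[RamExt x] V →ₗ[RamExt x] RamExt x) (lam : AddChar R ℂ)
    {l : ℕ} (hl : x ^ l = 0) : Representation ℂ (polarSubgroup h l) ℂ :=
  ((algebraMap ℂ (Module.End ℂ ℂ)).toMonoidHom : ℂ →* Module.End ℂ ℂ).comp (polarChar h lam hl)

/-- The space of the module `X = ind_{(A, V₀) ⋊ U}^{H ⋊ U} Z`. -/
abbrev WeilSpace (h : V →ₗ⋆[RamExt x] V →ₗ[RamExt x] RamExt x) (lam : AddChar R ℂ)
    {l : ℕ} (hl : x ^ l = 0) : Type _ :=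
  Representation.IndV (polarSubgroup h l).subtype (polarRep h lam hl)

/-- The action of `H ⋊ U` on the induced module `X`. -/
noncomputable def heisURep (h : V →ₗ⋆[RamExt x] V →ₗ[RamExt x] RamExt x) (lam : AddChar R ℂ)
    {l : ℕ} (hl : x ^ l = 0) : Representation ℂ (HeisU h) (WeilSpace h lam hl) :=
  Representation.ind (polarSubgroup h l).subtype (polarRep h lam hl)

/-- The Weil representation of `U` of type `μ`: the restriction of `X` to `U`. -/
noncomputable def weilRep (h : V →ₗ⋆[RamExt x] V →ₗ[RamExt x] RamExt x) (lam : AddChar R ℂ)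
    {l : ℕ} (hl : x ^ l = 0) : Representation ℂ (unitaryGroup h) (WeilSpace h lam hl) :=
  (heisURep h lam hl).comp SemidirectProduct.inr

/-- The vector `e_v = (0, v) ⊗ ζ` of `X`. Letting `v` run over representatives of `V / V₀` gives
a basis of `X`, and `e_v` changes by a non-zero scalar when `v` changes modulo `V₀`. -/
noncomputable def weilVec (h : V →ₗ⋆[RamExt x] V →ₗ[RamExt x] RamExt x) (lam : AddChar R ℂ)
    {l : ℕ} (hl : x ^ l = 0) (v : V) : WeilSpace h lam hl :=
  heisURep h lam hl (SemidirectProduct.inl ⟨0, v⟩)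
    (Representation.IndV.mk (polarSubgroup h l).subtype (polarRep h lam hl) 1 1)

theorem weilRep_weilVec (h : V →ₗ⋆[RamExt x] V →ₗ[RamExt x] RamExt x) (lam : AddChar R ℂ)
    {l : ℕ} (hl : x ^ l = 0) (g : unitaryGroup h) (v : V) :
    weilRep h lam hl g (weilVec h lam hl v) =
      weilVec h lam hl ((g : V ≃ₗ[RamExt x] V) v) := by
  have hfix : heisURep h lam hl (SemidirectProduct.inr g)
      (Representation.IndV.mk (polarSubgroup h l).subtype (polarRep h lam hl) 1 1) =
      Representation.IndV.mk (polarSubgroup h l).subtype (polarRep h lam hl) 1 1 := by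
    have hg : (SemidirectProduct.inr g : HeisU h)⁻¹ ∈ polarSubgroup h l :=
      (polarSubgroup h l).inv_mem (yPow x V l).zero_mem
    have h1 : polarRep h lam hl ⟨_, hg⟩ 1 = 1 := by
      have : (polarChar h lam hl) ⟨_, hg⟩ = 1 := by
        change muChar x lam ((SemidirectProduct.inr g : HeisU h)⁻¹).left.cen = 1
        rw [← map_inv, SemidirectProduct.left_inr]
        exact (muChar x lam).map_zero_eq_one
      simp [polarRep, this]
    have h2 := Representation.Coinvariants.mk_self_apply
      (Representation.tprod ((Representation.leftRegular ℂ (HeisU h)).comp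
        (polarSubgroup h l).subtype) (polarRep h lam hl)) ⟨_, hg⟩
      (TensorProduct.tmul ℂ (MonoidAlgebra.single 1 1) 1)
    rw [heisURep, Representation.ind_mk, one_mul]
    rw [Representation.tprod_apply, TensorProduct.map_tmul, h1] at h2
    simpa using h2
  have hmul : (SemidirectProduct.inr g : HeisU h) * SemidirectProduct.inl ⟨0, v⟩ =
      SemidirectProduct.inl ⟨0, (g : V ≃ₗ[RamExt x] V) v⟩ * SemidirectProduct.inr g := by
    have := SemidirectProduct.inl_aut (φ := heisAction h) g ⟨0, v⟩
    change SemidirectProduct.inl (⟨0, (g : V ≃ₗ[RamExt x] V) v⟩ : Heisenberg h) = _ at this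
    rw [this, map_inv, inv_mul_cancel_right]
  change heisURep h lam hl (SemidirectProduct.inr g) (heisURep h lam hl _ _) = _
  rw [← Module.End.mul_apply, ← map_mul, hmul, map_mul, Module.End.mul_apply, hfix]
  rfl

/-- `Top`: the `U`-submodule of `X` spanned by all `e_v` with `v` primitive, i.e. `v ∉ y V`. -/
noncomputable def top (h : V →ₗ⋆[RamExt x] V →ₗ[RamExt x] RamExt x) (lam : AddChar R ℂ)
    {l : ℕ} (hl : x ^ l = 0) : Subrepresentation (weilRep h lam hl) where
  toSubmodule := Submodule.span ℂ (weilVec h lam hl '' {v | v ∉ yPow x V 1})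
  apply_mem_toSubmodule := by
    intro g w hw
    induction hw using Submodule.span_induction with
    | mem w hw =>
      obtain ⟨v, hv, rfl⟩ := hw
      rw [weilRep_weilVec]
      refine Submodule.subset_span ⟨_, ?_, rfl⟩
      rintro ⟨z, hz⟩
      refine hv ⟨(g : V ≃ₗ[RamExt x] V).symm z, ?_⟩
      apply (g : V ≃ₗ[RamExt x] V).injective
      rw [← hz]
      simp
    | zero => simp
    | add a b _ _ ha hb => rw [map_add]; exact Submodule.add_mem _ ha hb
    | smul c a _ ha => rw [map_smul]; exact Submodule.smul_mem _ c ha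

/-- The number of `U`-orbits of `V ∖ y² V`. -/
noncomputable def orbitCount (h : V →ₗ⋆[RamExt x] V →ₗ[RamExt x] RamExt x) : ℕ :=
  Set.ncard {O : Set V | ∃ v : V, v ∉ yPow x V 2 ∧ O = MulAction.orbit (unitaryGroup h) v}

end Form

section Constituents

variable {G W : Type*} [Group G] [AddCommGroup W] [Module ℂ W]

/-- Isomorphism of irreducible subrepresentations. -/
def irredSetoid (ρ : Representation ℂ G W) :
    Setoid {σ : Subrepresentation ρ // σ.toRepresentation.IsIrreducible} where
  r σ τ := Nonempty (σ.1.toRepresentation.Equiv τ.1.toRepresentation)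
  iseqv := ⟨fun _ => ⟨.refl _⟩, fun ⟨e⟩ => ⟨e.symm⟩, fun ⟨e⟩ ⟨f⟩ => ⟨e.trans f⟩⟩

/-- The number of isomorphism classes of irreducible constituents of a complex representation of
a finite group. (By complete reducibility each constituent occurs as a subrepresentation.) -/
noncomputable def numConstituents (ρ : Representation ℂ G W) : ℕ :=
  Nat.card (Quotient (irredSetoid ρ))

/-- The number of irreducible constituents counted with multiplicity: the length of the
module over the group algebra. -/
noncomputable def lengthOf (ρ : Representation ℂ G W) : ℕ∞ :=
  Module.length (MonoidAlgebra ℂ G) ρ.asModule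

end Constituents

theorem pow_eq_zero_of_nilpotency {R : Type*} [CommRing R] [IsLocalRing R] {x : R} {l : ℕ}
    (hx : IsLocalRing.maximalIdeal R = Ideal.span {x})
    (hl : IsLeast {k : ℕ | IsLocalRing.maximalIdeal R ^ k = ⊥} l) : x ^ l = 0 := by
  have h1 : IsLocalRing.maximalIdeal R ^ l = ⊥ := hl.1
  rwa [hx, Ideal.span_singleton_pow, Ideal.span_singleton_eq_bot] at h1

end RamifiedWeil

/-! Write E for the algebra of U-endomorphisms of Top. By Maschke and Schur, if E is commutative
then Top is multiplicity-free and its number of constituents, counted either way, is dim E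
(`numConstituents_and_length`).

An endomorphism T is controlled by the vectors T(e_v), v primitive. If g in U multiplies e_v by a
scalar, it multiplies T(e_v) by the same scalar, and this restricts the support. Quasi-reflections
fixing v kill the coefficient at every w outside Av + V₀ (`exists_unitary_fixing`). Those moving v
inside v + V₀ kill the coefficient at αv unless N(α) ≡ 1 mod x^⌈l/2⌉ (`exists_unitary_scaling`), and
such an α agrees modulo y^l with a scalar of norm exactly 1. So T(e_v) is a combination of vectors
e_{zv} with zz* = 1, which are translates of e_v by central elements of U; hence E is commutative.
Conversely every such combination occurs, independently on each U-orbit of lines ℂe_v, because the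
projections onto orbits are equivariant. Thus dim E is the number of orbits of lines times the
number of norm-one scalars modulo y^l.

By a Witt-type theorem (`exists_unitary_of_quad_eq`) the orbits of primitive vectors correspond to
the values h(v, v), and the orbits of lines to these values modulo x^⌈l/2⌉. There are 2|R/x^⌊l/2⌋R|
= 2|x^⌈l/2⌉R| norm-one classes, which exactly compensates for the reduction: dim E is twice the
number N of values. On the other side, V ∖ y²V consists of primitive vectors and y times primitive
vectors, and h(v, v) is still an invariant of yv, so there are 2N orbits (`orbitCount_eq`).

Finally N depends only on the form over the residue field. In rank one the values form a coset of
the squares of units; for type {1, -ε} the reduced form is anisotropic and exactly the units occur;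
otherwise it is isotropic and every element of R occurs. -/

namespace RamifiedWeil

/-! ### Multiplicity-free modules and Schur's lemma. -/

section MultiplicityFree

variable {S M : Type*} [Ring S] [AddCommGroup M] [Module S M]

/-- A finite semisimple module with commutative endomorphism ring is a finite direct sum of
pairwise non-isomorphic simple modules. -/
theorem exists_multiplicityFree_decomposition [IsSemisimpleModule S M] [Module.Finite S M]
    (hcomm : ∀ f g : Module.End S M, f * g = g * f) :
    ∃ (n : ℕ) (N : Fin n → Submodule S M) (i₀ : ∀ i, N i →ₗ[S] M) (p₀ : ∀ i, M →ₗ[S] N i),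
      (∀ i, IsSimpleModule S (N i)) ∧ (∀ i v, p₀ i (i₀ i v) = v) ∧
      (∀ i j, i ≠ j → ∀ v, p₀ j (i₀ i v) = 0) ∧ (∀ v, ∑ i, i₀ i (p₀ i v) = v) ∧
      (∀ i j, i ≠ j → IsEmpty (N i ≃ₗ[S] N j)) ∧ Module.length S M = n := by
  classical
  obtain ⟨n, N, e, hN⟩ := IsSemisimpleModule.exists_linearEquiv_fin_dfinsupp S M
  let e' : M ≃ₗ[S] (Π i, N i) := e.trans DFinsupp.linearEquivFunOnFintype
  let i₀ : ∀ i, N i →ₗ[S] M := fun i => e'.symm.toLinearMap ∘ₗ LinearMap.single S (fun i => N i) i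
  let p₀ : ∀ i, M →ₗ[S] N i := fun i => LinearMap.proj i ∘ₗ e'.toLinearMap
  have h1 : ∀ i v, p₀ i (i₀ i v) = v := by intro i v; simp [p₀, i₀]
  have h2 : ∀ i j, i ≠ j → ∀ v, p₀ j (i₀ i v) = 0 := by
    intro i j hij v; simp [p₀, i₀, Pi.single_eq_of_ne hij.symm]
  refine ⟨n, N, i₀, p₀, hN, h1, h2, ?_, ?_, ?_⟩
  · intro v
    apply e'.injective
    rw [map_sum]
    simp only [i₀, p₀, LinearMap.comp_apply, LinearEquiv.coe_coe, LinearEquiv.apply_symm_apply]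
    exact Finset.univ_sum_single (e' v)
  · intro i j hij
    refine ⟨fun φ => ?_⟩
    have := IsSimpleModule.nontrivial S (N i)
    obtain ⟨v, hv⟩ := exists_ne (0 : N i)
    -- An isomorphism φ between two distinct summands, extended by zero, does not commute with the
    -- projection onto the first.
    have h := LinearMap.congr_fun
      (hcomm (i₀ j ∘ₗ φ.toLinearMap ∘ₗ p₀ i) (i₀ i ∘ₗ p₀ i)) (i₀ i v)
    simp only [Module.End.mul_apply, LinearMap.comp_apply, LinearEquiv.coe_coe, h1,
      h2 j i hij.symm, map_zero] at h
    have h' := congrArg (p₀ j) h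
    rw [h1, map_zero] at h'
    exact hv (by simpa using h')
  · rw [e'.length_eq, Module.length_pi_of_fintype]
    simp [Module.length_eq_one]

/-- Schur's lemma: diagonal blocks of an endomorphism are scalars because k is algebraically closed,
and off-diagonal blocks vanish because distinct summands are not isomorphic. -/
theorem finrank_end_of_multiplicityFree {k : Type*} [Field k] [IsAlgClosed k] [Algebra k S]
    [Module k M] [IsScalarTower k S M] [FiniteDimensional k M] {n : ℕ} {N : Fin n → Submodule S M}
    {i₀ : ∀ i, N i →ₗ[S] M} {p₀ : ∀ i, M →ₗ[S] N i} (hN : ∀ i, IsSimpleModule S (N i))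
    (h1 : ∀ i v, p₀ i (i₀ i v) = v) (h2 : ∀ i j, i ≠ j → ∀ v, p₀ j (i₀ i v) = 0)
    (h3 : ∀ v, ∑ i, i₀ i (p₀ i v) = v) (h4 : ∀ i j, i ≠ j → IsEmpty (N i ≃ₗ[S] N j)) :
    Module.finrank k (Module.End S M) = n := by
  classical
  let F : (Fin n → k) →ₗ[k] Module.End S M :=
    { toFun := fun c => ∑ i, c i • (i₀ i ∘ₗ p₀ i)
      map_add' := fun c d => by simp [add_smul, Finset.sum_add_distrib]
      map_smul' := fun a c => by simp [Finset.smul_sum, mul_smul] }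
  have hF : ∀ (c : Fin n → k) i (v : N i), F c (i₀ i v) = c i • i₀ i v := by
    intro c i v
    simp only [F, LinearMap.coe_mk, AddHom.coe_mk, LinearMap.sum_apply, LinearMap.smul_apply,
      LinearMap.comp_apply]
    rw [Finset.sum_eq_single i]
    · rw [h1]
    · intro j _ hj; rw [h2 i j hj.symm, map_zero, smul_zero]
    · simp
  have hinj : Function.Injective F := by
    intro c d hcd
    funext i
    have := IsSimpleModule.nontrivial S (N i)
    obtain ⟨v, hv⟩ := exists_ne (0 : N i)
    have h := LinearMap.congr_fun hcd (i₀ i v)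
    rw [hF, hF] at h
    refine smul_left_injective k (fun h0 => hv ?_) h
    have := congrArg (p₀ i) h0
    rwa [h1, map_zero] at this
  have hsurj : Function.Surjective F := by
    intro f
    have hfin : ∀ i, FiniteDimensional k (N i) := fun i =>
      Module.Finite.of_injective ((i₀ i).restrictScalars k)
        (Function.LeftInverse.injective (g := p₀ i) (h1 i))
    have hs : ∀ i, ∃ c : k, ∀ v, p₀ i (f (i₀ i v)) = c • v := by
      intro i
      obtain ⟨c, hc⟩ := (IsSimpleModule.algebraMap_end_bijective_of_isAlgClosed
        (A := S) (V := N i) k).2 (p₀ i ∘ₗ f ∘ₗ i₀ i)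
      exact ⟨c, fun v => (LinearMap.congr_fun hc v).symm⟩
    choose c hc using hs
    have h0 : ∀ i j, i ≠ j → ∀ v, p₀ j (f (i₀ i v)) = 0 := by
      intro i j hij v
      by_contra hne
      have hb := LinearMap.bijective_of_ne_zero (f := p₀ j ∘ₗ f ∘ₗ i₀ i)
        (fun hz => hne (LinearMap.congr_fun hz v))
      exact (h4 i j hij).false (LinearEquiv.ofBijective _ hb)
    refine ⟨c, LinearMap.ext fun v => ?_⟩
    have key : ∀ i (w : N i), F c (i₀ i w) = f (i₀ i w) := by
      intro i w
      rw [hF, ← h3 (f (i₀ i w)), Finset.sum_eq_single i]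
      · rw [hc]
        exact (LinearMap.map_smul_of_tower (i₀ i) (c i) w).symm
      · intro j _ hj; rw [h0 i j hj.symm, map_zero]
      · simp
    rw [← h3 v, map_sum, map_sum]
    exact Finset.sum_congr rfl fun i _ => key i _
  rw [← (LinearEquiv.ofBijective F ⟨hinj, hsurj⟩).finrank_eq, Module.finrank_fin_fun]

end MultiplicityFree

/-! ### Representations as modules over the group algebra. -/

section

variable {G W : Type*} [Group G] [AddCommGroup W] [Module ℂ W]

/-- The module of a subrepresentation is the corresponding submodule. -/
noncomputable def asModuleEquivAsSubmodule {ρ : Representation ℂ G W} (σ : Subrepresentation ρ) :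
    σ.toRepresentation.asModule ≃ₗ[MonoidAlgebra ℂ G] σ.asSubmodule :=
  let e : σ.toRepresentation.asModule ≃+ σ.asSubmodule :=
    { toFun := fun v => ⟨ρ.asModuleEquiv.symm (σ.toRepresentation.asModuleEquiv v : W),
        (σ.toRepresentation.asModuleEquiv v).2⟩
      invFun := fun v => σ.toRepresentation.asModuleEquiv.symm ⟨ρ.asModuleEquiv v, v.2⟩
      left_inv := fun _ => rfl
      right_inv := fun _ => rfl
      map_add' := fun _ _ => rfl }
  { e with
    map_smul' := by
      intro c v
      change e (c • v) = c • e v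
      induction c using MonoidAlgebra.induction_linear with
      | zero => rw [zero_smul, zero_smul, map_zero]
      | add a b ha hb => rw [add_smul, add_smul, map_add, ha, hb]
      | single g a =>
        apply Subtype.ext
        rw [Representation.single_smul, Submodule.coe_smul, Representation.single_smul]
        rfl }

theorem isIrreducible_iff_isSimpleModule {ρ : Representation ℂ G W} (σ : Subrepresentation ρ) :
    σ.toRepresentation.IsIrreducible ↔ IsSimpleModule (MonoidAlgebra ℂ G) σ.asSubmodule := by
  rw [Representation.irreducible_iff_isSimpleModule_asModule]
  exact (asModuleEquivAsSubmodule σ).isSimpleModule_iff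

/-- Isomorphism of representations in terms of modules over the group algebra. -/
theorem nonempty_equiv_iff {W' : Type*} [AddCommGroup W'] [Module ℂ W']
    (σ : Representation ℂ G W) (τ : Representation ℂ G W') :
    Nonempty (σ.Equiv τ) ↔ Nonempty (σ.asModule ≃ₗ[MonoidAlgebra ℂ G] τ.asModule) := by
  constructor
  · rintro ⟨φ⟩
    exact ⟨LinearEquiv.ofBijective (Representation.IntertwiningMap.equivLinearMapAsModule σ τ
      φ.toIntertwiningMap) φ.toLinearEquiv.bijective⟩
  · rintro ⟨φ⟩
    let f := (Representation.IntertwiningMap.equivLinearMapAsModule σ τ).symm φ.toLinearMap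
    exact ⟨Representation.Equiv.mk (LinearEquiv.ofBijective f.toLinearMap φ.bijective)
      f.isIntertwining'⟩

theorem nonempty_subrepresentation_equiv_iff {ρ : Representation ℂ G W}
    (σ τ : Subrepresentation ρ) :
    Nonempty (σ.toRepresentation.Equiv τ.toRepresentation) ↔
      Nonempty (σ.asSubmodule ≃ₗ[MonoidAlgebra ℂ G] τ.asSubmodule) := by
  rw [nonempty_equiv_iff]
  exact ⟨fun ⟨φ⟩ => ⟨(asModuleEquivAsSubmodule σ).symm.trans
      (φ.trans (asModuleEquivAsSubmodule τ))⟩,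
    fun ⟨φ⟩ => ⟨(asModuleEquivAsSubmodule σ).trans
      (φ.trans (asModuleEquivAsSubmodule τ).symm)⟩⟩

/-- If the endomorphism algebra of a complex representation of a finite group is commutative of
dimension `n`, then the representation is multiplicity-free with `n` irreducible constituents. -/
theorem numConstituents_and_length [Finite G] [FiniteDimensional ℂ W] (ρ : Representation ℂ G W)
    (hcomm : ∀ f g : Module.End (MonoidAlgebra ℂ G) ρ.asModule, f * g = g * f) {n : ℕ}
    (hn : Module.finrank ℂ (Module.End (MonoidAlgebra ℂ G) ρ.asModule) = n) :
    numConstituents ρ = n ∧ lengthOf ρ = n := by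
  -- Invertibility of the group order is what Maschke's theorem needs.
  have : NeZero (Nat.card G : ℂ) := ⟨Nat.cast_ne_zero.2 Nat.card_pos.ne'⟩
  have : Module.Finite (MonoidAlgebra ℂ G) ρ.asModule :=
    Module.Finite.of_restrictScalars_finite ℂ _ _
  obtain ⟨n', N, i₀, p₀, hN, h1, h2, h3, h4, h5⟩ := exists_multiplicityFree_decomposition hcomm
  have hn' := finrank_end_of_multiplicityFree (k := ℂ) hN h1 h2 h3 h4
  obtain rfl : n' = n := hn'.symm.trans hn
  refine ⟨?_, h5⟩
  let F : Fin n' → Quotient (irredSetoid ρ) := fun i =>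
    Quotient.mk _ ⟨Subrepresentation.ofSubmodule' (N i), (isIrreducible_iff_isSimpleModule _).2 (hN i)⟩
  have hF : Function.Bijective F := by
    constructor
    · intro i j hij
      by_contra hne
      obtain ⟨e⟩ := (nonempty_subrepresentation_equiv_iff _ _).1 (Quotient.exact hij)
      exact (h4 i j hne).false e
    · intro c
      induction c using Quotient.inductionOn with
      | h σ =>
        obtain ⟨σ, hσ⟩ := σ
        have hs := (isIrreducible_iff_isSimpleModule σ).1 hσ
        have := IsSimpleModule.nontrivial (MonoidAlgebra ℂ G) σ.asSubmodule
        obtain ⟨v, hv⟩ := exists_ne (0 : σ.asSubmodule)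
        -- A non-zero vector of an irreducible σ has a non-zero component in some summand, and Schur
        -- makes σ isomorphic to that summand.
        have : ∃ i, p₀ i v ≠ 0 := by
          by_contra! hz
          apply hv
          apply Subtype.ext
          rw [← h3 v]
          simp [hz]
        obtain ⟨i, hi⟩ := this
        have hb := LinearMap.bijective_of_ne_zero (f := p₀ i ∘ₗ σ.asSubmodule.subtype)
          (fun hz => hi (LinearMap.congr_fun hz v))
        refine ⟨i, Quotient.sound ?_⟩
        exact (nonempty_subrepresentation_equiv_iff _ _).2 ⟨(LinearEquiv.ofBijective _ hb).symm⟩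
  rw [numConstituents, ← Nat.card_congr (Equiv.ofBijective F hF), Nat.card_eq_fintype_card,
    Fintype.card_fin]

end

/-! ### The chain ring R and its ramified extension A. -/

/-- `x` generates the maximal ideal of a chain ring of nilpotency degree `l` in which `2` is a
unit. -/
structure IsUniformizer {R : Type*} [CommRing R] (x : R) (l : ℕ) : Prop where
  two : IsUnit (2 : R)
  unit_or : ∀ r : R, IsUnit r ∨ x ∣ r
  not_unit : ¬ IsUnit x
  pow : x ^ l = 0
  pow_pred : x ^ (l - 1) ≠ 0
  pos : 1 ≤ l

theorem isUniformizer_of_isLocalRing {R : Type*} [CommRing R] [IsLocalRing R]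
    (hodd : Odd (ringChar R)) {x : R} (hx : IsLocalRing.maximalIdeal R = Ideal.span {x}) {l : ℕ}
    (hl : IsLeast {k : ℕ | IsLocalRing.maximalIdeal R ^ k = ⊥} l) : IsUniformizer x l := by
  have hpow : ∀ k, IsLocalRing.maximalIdeal R ^ k = ⊥ ↔ x ^ k = 0 := by
    intro k
    rw [hx, Ideal.span_singleton_pow, Ideal.span_singleton_eq_bot]
  have hpos : 1 ≤ l := by
    by_contra h0
    obtain rfl : l = 0 := by omega
    have := (hpow 0).1 hl.1
    simp at this
  refine ⟨?_, ?_, ?_, (hpow l).1 hl.1, ?_, hpos⟩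
  · obtain ⟨k, hk⟩ := hodd
    have h0 : ((ringChar R : ℕ) : R) = 0 := ringChar.Nat.cast_ringChar
    rw [hk] at h0
    push_cast at h0
    -- The characteristic is 2k + 1, so -k is the inverse of 2.
    exact .of_mul_eq_one (-(k : R)) (by linear_combination -h0)
  · intro r
    by_cases hr : IsUnit r
    · exact .inl hr
    · right
      have : r ∈ IsLocalRing.maximalIdeal R := (IsLocalRing.mem_maximalIdeal r).2 hr
      rwa [hx, Ideal.mem_span_singleton] at this
  · have : x ∈ IsLocalRing.maximalIdeal R := hx ▸ Ideal.mem_span_singleton_self x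
    exact (IsLocalRing.mem_maximalIdeal x).1 this
  · intro h
    have := hl.2 ((hpow (l - 1)).2 h)
    omega

namespace IsUniformizer

section Base

variable {R : Type*} [CommRing R] {x : R} {l : ℕ}

theorem not_isUnit_iff (H : IsUniformizer x l) {r : R} : ¬ IsUnit r ↔ x ∣ r :=
  ⟨(H.unit_or r).resolve_left, fun ⟨_, hs⟩ hr => H.not_unit (isUnit_of_mul_isUnit_left (hs ▸ hr))⟩

theorem isUnit_iff (H : IsUniformizer x l) {r : R} : IsUnit r ↔ ¬ x ∣ r := by
  rw [← H.not_isUnit_iff, not_not]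

theorem isUnit_add (H : IsUniformizer x l) {r s : R} (hr : IsUnit r) (hs : x ∣ s) :
    IsUnit (r + s) := by
  rw [H.isUnit_iff] at hr ⊢
  exact fun h => hr ((dvd_add_left hs).1 h)

theorem dvd_or_dvd (H : IsUniformizer x l) {r s : R} (h : x ∣ r * s) : x ∣ r ∨ x ∣ s := by
  by_contra! hc
  exact H.isUnit_iff.1 ((H.isUnit_iff.2 hc.1).mul (H.isUnit_iff.2 hc.2)) h

theorem exists_eq_pow_mul (H : IsUniformizer x l) (r : R) (n : ℕ) :
    x ^ n ∣ r ∨ ∃ j < n, ∃ u, IsUnit u ∧ r = x ^ j * u := by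
  induction n with
  | zero => left; simp
  | succ n ih =>
    rcases ih with ⟨u, hu⟩ | ⟨j, hj, h⟩
    · rcases H.unit_or u with h | ⟨s, hs⟩
      · exact .inr ⟨n, by omega, u, h, hu⟩
      · exact .inl ⟨s, by rw [hu, hs, pow_succ, mul_assoc]⟩
    · exact .inr ⟨j, by omega, h⟩

theorem pow_eq_zero_iff (H : IsUniformizer x l) {n : ℕ} : x ^ n = 0 ↔ l ≤ n := by
  constructor
  · intro h
    by_contra hn
    refine H.pow_pred ?_
    rw [show l - 1 = n + (l - 1 - n) by omega, pow_add, h, zero_mul]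
  · intro h
    rw [← Nat.add_sub_cancel' h, pow_add, H.pow, zero_mul]

theorem pow_mul_eq_zero_iff (H : IsUniformizer x l) {n : ℕ} (hn : n ≤ l) {r : R} :
    x ^ n * r = 0 ↔ x ^ (l - n) ∣ r := by
  constructor
  · intro h
    rcases H.exists_eq_pow_mul r (l - n) with h' | ⟨j, hj, u, hu, rfl⟩
    · exact h'
    · rw [← mul_assoc, ← pow_add, hu.mul_left_eq_zero, H.pow_eq_zero_iff] at h
      omega
  · rintro ⟨s, rfl⟩
    rw [← mul_assoc, ← pow_add, Nat.add_sub_cancel' hn, H.pow, zero_mul]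

/-- Every element of `1 + x R` is the square of an element of `1 + x R`. -/
theorem exists_sq_eq_one_add [Finite R] (H : IsUniformizer x l) {r : R} (hr : x ∣ r) :
    ∃ s, x ∣ s ∧ (1 + s) ^ 2 = 1 + r := by
  -- Finiteness replaces Hensel's lemma: s ↦ (1 + s)² - 1 is injective on xR, since f(a) - f(b) = (2
  -- + a + b)(a - b) with a unit factor, hence surjective.
  let f : {s : R // x ∣ s} → {s : R // x ∣ s} := fun s =>
    ⟨2 * s.1 + s.1 ^ 2, dvd_add (s.2.mul_left 2) (s.2.trans (dvd_pow_self _ two_ne_zero))⟩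
  have hf : Function.Injective f := by
    rintro ⟨a, ha⟩ ⟨b, hb⟩ hab
    have h := congrArg Subtype.val hab
    have hu : IsUnit (2 + (a + b)) := H.isUnit_add H.two (dvd_add ha hb)
    have : (2 + (a + b)) * (a - b) = 0 := by
      simp only [f] at h
      linear_combination h
    exact Subtype.ext (sub_eq_zero.1 (hu.mul_right_eq_zero.1 this))
  obtain ⟨⟨s, hs⟩, h⟩ := (Finite.injective_iff_surjective.1 hf) ⟨r, hr⟩
  refine ⟨s, hs, ?_⟩
  have := congrArg Subtype.val h
  simp only [f] at this
  linear_combination this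

theorem isSquare_of_dvd_sub [Finite R] (H : IsUniformizer x l) {u a : R} (hu : IsUnit u)
    (h : x ∣ u - a ^ 2) : ∃ b, b ^ 2 = u ∧ x ∣ b - a := by
  have ha : IsUnit a := by
    rw [H.isUnit_iff] at hu ⊢
    intro h'
    exact hu (by simpa using dvd_add h (h'.trans (dvd_pow_self a two_ne_zero)))
  obtain ⟨a, rfl⟩ := ha
  obtain ⟨s, hs, h2⟩ := H.exists_sq_eq_one_add (r := (u - a ^ 2) * (a⁻¹ : Rˣ) ^ 2) (h.mul_right _)
  refine ⟨a * (1 + s), ?_, ?_⟩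
  · rw [mul_pow, h2]
    have : (a : R) * (a⁻¹ : Rˣ) = 1 := a.mul_inv
    linear_combination (u - a ^ 2) * (a * (a⁻¹ : Rˣ) + 1) * this
  · exact (hs.mul_left (a : R)).trans (dvd_of_eq (by ring))

/-- The quadratic equation `n r² + 2 r = k` is solvable whenever `n k` is in the maximal ideal. -/
theorem exists_quadratic [Finite R] (H : IsUniformizer x l) {n k : R} (h : x ∣ n * k) :
    ∃ r, k ∣ r ∧ n * r ^ 2 + 2 * r = k := by
  obtain ⟨s, hs, h2⟩ := H.exists_sq_eq_one_add h
  have hu : IsUnit (2 + s) := H.isUnit_add H.two hs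
  obtain ⟨u, hu⟩ := hu
  have hi : (2 + s) * (u⁻¹ : Rˣ) = 1 := by rw [← hu, Units.mul_inv]
  -- Completing the square suggests r = s/n; since s(2 + s) = nk, this is k/(2 + s), which makes
  -- sense even when n is not invertible.
  refine ⟨k * (u⁻¹ : Rˣ), dvd_mul_right _ _, ?_⟩
  have h3 : n * k = s * (2 + s) := by linear_combination -h2
  linear_combination (k * (u⁻¹ : Rˣ) ^ 2) * h3 + (k * ((u⁻¹ : Rˣ) * s + 1)) * hi

end Base

section Ext

variable {R : Type*} [CommRing R] {x : R} {l : ℕ}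

local notation "A" => RamExt x
local notation "y" => gen x

theorem _root_.RamifiedWeil.norm_eq (α : RamExt x) :
    α.norm = α.re ^ 2 - x * α.im ^ 2 := by
  rw [QuadraticAlgebra.norm_def]; ring

theorem isUnit_ext_iff (H : IsUniformizer x l) {α : A} : IsUnit α ↔ IsUnit α.re := by
  rw [QuadraticAlgebra.isUnit_iff_norm_isUnit, norm_eq, H.isUnit_iff, H.isUnit_iff, not_iff_not,
    dvd_sub_left (dvd_mul_right _ _), sq]
  exact ⟨fun h => (H.dvd_or_dvd h).elim id id, fun h => h.mul_left _⟩

theorem gen_dvd_iff {α : A} : y ∣ α ↔ x ∣ α.re := by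
  constructor
  · rintro ⟨β, rfl⟩
    simp
  · rintro ⟨r, hr⟩
    exact ⟨⟨α.im, r⟩, by ext <;> simp [hr]⟩

theorem gen_dvd_iff_not_isUnit (H : IsUniformizer x l) {α : A} : y ∣ α ↔ ¬ IsUnit α := by
  rw [gen_dvd_iff, H.isUnit_ext_iff, H.not_isUnit_iff]

theorem gen_sq : y ^ 2 = algebraMap R A x := by rw [sq, gen_mul_gen]

theorem gen_pow_two_mul (n : ℕ) : y ^ (2 * n) = algebraMap R A (x ^ n) := by
  rw [pow_mul, gen_sq, map_pow]

/-- Even powers of y are powers of x, and one more factor y interchanges the coordinates with an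
extra x on the real one. The two exponents are ⌈n/2⌉ and ⌊n/2⌋; this is the source of every later `l
- l / 2` and `l / 2`. -/
theorem gen_pow_dvd_iff (n : ℕ) {α : A} :
    y ^ n ∣ α ↔ x ^ (n - n / 2) ∣ α.re ∧ x ^ (n / 2) ∣ α.im := by
  rcases Nat.even_or_odd' n with ⟨k, rfl | rfl⟩
  · rw [show 2 * k - 2 * k / 2 = k by omega, show 2 * k / 2 = k by omega, gen_pow_two_mul]
    exact QuadraticAlgebra.algebraMap_dvd_iff
  · rw [show 2 * k + 1 - (2 * k + 1) / 2 = k + 1 by omega, show (2 * k + 1) / 2 = k by omega,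
      pow_succ, gen_pow_two_mul]
    constructor
    · rintro ⟨β, rfl⟩
      rw [mul_assoc]
      constructor
      · exact ⟨β.im, by simp [-map_pow, pow_succ, mul_assoc]⟩
      · exact ⟨β.re, by simp [-map_pow]⟩
    · rintro ⟨⟨r, hr⟩, ⟨s, hs⟩⟩
      refine ⟨⟨s, r⟩, ?_⟩
      rw [mul_assoc]
      ext
      · simp [-map_pow, hr, pow_succ, mul_assoc]
      · simp [-map_pow, hs]

theorem gen_pow_eq_zero (H : IsUniformizer x l) : y ^ (2 * l) = 0 := by
  rw [gen_pow_two_mul, H.pow, map_zero]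

theorem gen_pow_pred_ne_zero (H : IsUniformizer x l) : y ^ (2 * l - 1) ≠ 0 := by
  have hl := H.pos
  rw [show 2 * l - 1 = 2 * (l - 1) + 1 by omega, pow_succ, gen_pow_two_mul]
  intro h
  have := congrArg QuadraticAlgebra.im h
  rw [QuadraticAlgebra.im_mul, QuadraticAlgebra.algebraMap_re,
    QuadraticAlgebra.algebraMap_im] at this
  exact H.pow_pred (by simpa using this)

theorem exists_eq_gen_pow_mul (H : IsUniformizer x l) (α : A) (n : ℕ) :
    y ^ n ∣ α ∨ ∃ j < n, ∃ η, IsUnit η ∧ α = y ^ j * η := by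
  induction n with
  | zero => left; simp
  | succ n ih =>
    rcases ih with ⟨u, hu⟩ | ⟨j, hj, h⟩
    · by_cases h : IsUnit u
      · exact .inr ⟨n, by omega, u, h, hu⟩
      · obtain ⟨s, hs⟩ := H.gen_dvd_iff_not_isUnit.2 h
        exact .inl ⟨s, by rw [hu, hs, pow_succ, mul_assoc]⟩
    · exact .inr ⟨j, by omega, h⟩

theorem gen_pow_mul_eq_zero (H : IsUniformizer x l) {n : ℕ} {α : A}
    (h : y ^ n * α = 0) : y ^ (2 * l - n) ∣ α := by
  rcases H.exists_eq_gen_pow_mul α (2 * l - n) with h' | ⟨j, hj, η, hη, rfl⟩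
  · exact h'
  · rw [← mul_assoc, ← pow_add, hη.mul_left_eq_zero] at h
    refine absurd ?_ H.gen_pow_pred_ne_zero
    rw [show 2 * l - 1 = n + j + (2 * l - 1 - (n + j)) by omega, pow_add, h, zero_mul]

theorem star_gen_pow (n : ℕ) : star (y ^ n) = (-1) ^ n * y ^ n := by
  rw [star_pow, star_gen, neg_pow]

theorem gen_pow_dvd_star {n : ℕ} {α : A} (h : y ^ n ∣ α) : y ^ n ∣ star α := by
  obtain ⟨β, rfl⟩ := h
  rw [star_mul', star_gen_pow]
  exact ⟨(-1) ^ n * star β, by ring⟩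

theorem norm_gen_pow (n : ℕ) : (y ^ n).norm = (-x) ^ n := by
  rw [map_pow, norm_eq]; simp

end Ext

end IsUniformizer

theorem IsUniformizer.isUnit_ext_add {R : Type*} [CommRing R] {x : R} {l : ℕ}
    (H : IsUniformizer x l) {α β : RamExt x} (hα : IsUnit α) (hβ : gen x ∣ β) :
    IsUnit (α + β) := by
  by_contra hc
  rw [← H.gen_dvd_iff_not_isUnit, dvd_add_left hβ, H.gen_dvd_iff_not_isUnit] at hc
  exact hc hα

/-! ### Hermitian geometry: quasi-reflections and a Witt theorem for primitive vectors. -/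

section Hermitian

variable {R : Type*} [CommRing R] {x : R} {l : ℕ} {V : Type*} [AddCommGroup V]
  [Module (RamExt x) V] {h : V →ₗ⋆[RamExt x] V →ₗ[RamExt x] RamExt x}

theorem yPow_le {i j : ℕ} (hij : i ≤ j) : yPow x V j ≤ yPow x V i := by
  rintro _ ⟨w, rfl⟩
  refine ⟨gen x ^ (j - i) • w, ?_⟩
  simp only [LinearMap.lsmul_apply, smul_smul, ← pow_add, Nat.add_sub_cancel' hij]

theorem smul_mem_yPow {j : ℕ} {α : RamExt x} (hα : gen x ^ j ∣ α) (v : V) :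
    α • v ∈ yPow x V j := by
  obtain ⟨β, rfl⟩ := hα
  exact ⟨β • v, by simp [smul_smul, mul_comm]⟩

@[simp] theorem form_smul_left (α : RamExt x) (u v : V) : h (α • u) v = star α * h u v := by
  simp [starRingEnd_apply]

theorem gen_pow_dvd_form {j : ℕ} {v : V} (hv : v ∈ yPow x V j) (u : V) : gen x ^ j ∣ h u v := by
  obtain ⟨w, rfl⟩ := hv
  exact ⟨h u w, by simp⟩

/-- The scalar by which a vector pairs with itself. -/
def quad (h : V →ₗ⋆[RamExt x] V →ₗ[RamExt x] RamExt x) (v : V) : R := (h v v).re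

theorem quad_unitary (g : unitaryGroup h) (v : V) :
    quad h ((g : V ≃ₗ[RamExt x] V) v) = quad h v := by
  rw [quad, quad, g.2 v v]

namespace IsNondegHermitian

theorem form_self (hh : IsNondegHermitian h) (H : IsUniformizer x l) (v : V) :
    h v v = algebraMap R (RamExt x) (quad h v) := by
  ext
  · simp [quad]
  · have h1 := congrArg QuadraticAlgebra.im (hh.symm v v)
    simp only [QuadraticAlgebra.im_star] at h1
    have : (2 : R) * (h v v).im = 0 := by linear_combination h1
    simpa using H.two.mul_right_eq_zero.1 this

/-- If h(v, -) is divisible by y^j, divide its values on a basis; by non-degeneracy the quotient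
functional is h(w, -), and v is y^j w up to the sign coming from (y^j)* = (-1)^j y^j. -/
theorem mem_yPow_iff [Module.Free (RamExt x) V] (hh : IsNondegHermitian h) {j : ℕ} {v : V} :
    v ∈ yPow x V j ↔ ∀ u, gen x ^ j ∣ h u v := by
  refine ⟨gen_pow_dvd_form, fun hv => ?_⟩
  let b := Module.Free.chooseBasis (RamExt x) V
  have hb : ∀ i, ∃ β, h v (b i) = gen x ^ j * β := by
    intro i
    rw [hh.symm (b i) v]
    exact IsUniformizer.gen_pow_dvd_star (hv (b i))
  choose β hβ using hb
  obtain ⟨w, hw⟩ := hh.nondeg.2 (b.constr (RamExt x) β)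
  refine ⟨((-1) ^ j : RamExt x) • w, hh.nondeg.1 (b.ext fun i => ?_)⟩
  have hwi : h w (b i) = β i := by
    rw [show h w = _ from hw, Module.Basis.constr_basis]
  change h (gen x ^ j • ((-1) ^ j : RamExt x) • w) (b i) = h v (b i)
  rw [smul_smul, form_smul_left, star_mul', IsUniformizer.star_gen_pow, hwi, hβ, star_pow,
    star_neg, star_one]
  have : ((-1) ^ j * (-1) ^ j : RamExt x) = 1 := by rw [← mul_pow]; simp
  linear_combination (gen x ^ j * β i) * this

theorem notMem_yPow_one_iff [Module.Free (RamExt x) V] (hh : IsNondegHermitian h)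
    (H : IsUniformizer x l) {v : V} : v ∉ yPow x V 1 ↔ ∃ u, h u v = 1 := by
  rw [hh.mem_yPow_iff]
  push Not
  constructor
  · rintro ⟨u, hu⟩
    rw [pow_one, H.gen_dvd_iff_not_isUnit, not_not] at hu
    obtain ⟨η, hη⟩ := hu
    refine ⟨star (η⁻¹ : (RamExt x)ˣ).1 • u, ?_⟩
    rw [form_smul_left, star_star, ← hη, Units.inv_mul]
  · rintro ⟨u, hu⟩
    refine ⟨u, ?_⟩
    rw [pow_one, H.gen_dvd_iff_not_isUnit, not_not, hu]
    exact isUnit_one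

theorem notMem_yPow_one_of_isUnit (H : IsUniformizer x l) {u v : V} (hu : IsUnit (h u v)) :
    v ∉ yPow x V 1 := by
  intro hv
  have := gen_pow_dvd_form (h := h) hv u
  rw [pow_one, H.gen_dvd_iff_not_isUnit] at this
  exact this hu

/-- The quasi-reflection `w ↦ w + κ h(a, w) a`. -/
theorem exists_reflection (hh : IsNondegHermitian h) (a : V) {κ : RamExt x}
    (hκ : κ + star κ + κ * star κ * h a a = 0) :
    ∃ g : unitaryGroup h, ∀ w, (g : V ≃ₗ[RamExt x] V) w = w + (κ * h a w) • a := by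
  let f : RamExt x → V →ₗ[RamExt x] V := fun c =>
    { toFun := fun w => w + (c * h a w) • a
      map_add' := fun u v => by rw [map_add, mul_add, add_smul]; abel
      map_smul' := fun α u => by
        simp only [map_smul, smul_eq_mul, RingHom.id_apply, smul_add, smul_smul]
        congr 2; ring }
  -- The condition on κ is symmetric under the involution, so the map attached to `star κ` is a
  -- two-sided inverse.
  have hf : ∀ c, c + star c + c * star c * h a a = 0 → ∀ w, f c (f (star c) w) = w := by
    intro c hc w
    change (w + (star c * h a w) • a) + (c * h a (w + (star c * h a w) • a)) • a = w
    rw [map_add, map_smul, smul_eq_mul, add_assoc, ← add_smul]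
    rw [show star c * h a w + c * (h a w + star c * h a w * h a a) = 0 by
      linear_combination (h a w) * hc, zero_smul, add_zero]
  let e : V ≃ₗ[RamExt x] V := LinearEquiv.ofLinearMap (f κ) (f (star κ))
    (LinearMap.ext (hf κ hκ))
    (LinearMap.ext fun w => by
      have := hf (star κ) (by rw [star_star]; linear_combination hκ) w
      rwa [star_star] at this)
  refine ⟨⟨e, fun u v => ?_⟩, fun w => rfl⟩
  change h (u + (κ * h a u) • a) (v + (κ * h a v) • a) = h u v
  simp only [map_add, LinearMap.add_apply, form_smul_left, map_smul, star_mul', ← hh.symm a u,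
    smul_eq_mul]
  linear_combination (h u a * h a v) * hκ

/-- For κ = r + ty the unitarity condition is h(a, a)r² + 2r = h(a, a)xt², solvable for r by
`exists_quadratic`. So the imaginary part, which is what μ sees, is a free parameter, while r is
divisible by xt², so κ is no less divisible than ty. -/
theorem exists_reflection_im [Finite R] (hh : IsNondegHermitian h) (H : IsUniformizer x l) (a : V)
    (t : R) : ∃ κ : RamExt x, κ.im = t ∧ algebraMap R (RamExt x) t * gen x ∣ κ ∧
      ∃ g : unitaryGroup h, ∀ w, (g : V ≃ₗ[RamExt x] V) w = w + (κ * h a w) • a := by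
  obtain ⟨r, ⟨e, he⟩, hr⟩ := H.exists_quadratic (n := quad h a) (k := quad h a * x * t ^ 2)
    ⟨quad h a ^ 2 * t ^ 2, by ring⟩
  refine ⟨⟨r, t⟩, rfl, ⟨⟨1, t * quad h a * e⟩, ?_⟩, hh.exists_reflection a ?_⟩
  · ext
    · simp [he]; ring
    · simp
  · rw [hh.form_self H]
    ext
    · simp
      linear_combination hr
    · simp
      ring

/-- Scalars of norm one belong to the unitary group. -/
def _root_.RamifiedWeil.scalarUnitary (h : V →ₗ⋆[RamExt x] V →ₗ[RamExt x] RamExt x) (z : RamExt x)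
    (hz : z * star z = 1) : unitaryGroup h :=
  ⟨LinearEquiv.ofLinearMap (LinearMap.lsmul (RamExt x) V z) (LinearMap.lsmul (RamExt x) V (star z))
    (LinearMap.ext fun v => by simp [smul_smul, mul_comm (star z) z, hz])
    (LinearMap.ext fun v => by simp [smul_smul, hz]), fun u v => by
      change h (z • u) (z • v) = h u v
      rw [form_smul_left, map_smul, smul_eq_mul]
      linear_combination (h u v) * hz⟩

/-- Reflect along v - w with κ = -1/d, where d = h(v - w, v). Equal lengths give h(v - w, v - w) = d
+ d*, which is exactly the unitarity condition. -/
theorem exists_unitary_of_isUnit (hh : IsNondegHermitian h) {v w : V} (hvw : h v v = h w w)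
    (hu : IsUnit (h v v - h w v)) : ∃ g : unitaryGroup h, (g : V ≃ₗ[RamExt x] V) v = w := by
  obtain ⟨d, hd⟩ := hu
  have hd' : h (v - w) v = d := by rw [map_sub, LinearMap.sub_apply, hd]
  have hi : (d : RamExt x) * (d⁻¹ : (RamExt x)ˣ) = 1 := d.mul_inv
  have hi' : star (d : RamExt x) * star ((d⁻¹ : (RamExt x)ˣ) : RamExt x) = 1 := by
    rw [← star_mul', hi, star_one]
  have hs : star (d : RamExt x) = h v v - h v w := by
    rw [hd, star_sub, ← hh.symm, ← hh.symm]
  obtain ⟨g, hg⟩ := hh.exists_reflection (v - w) (κ := -(d⁻¹ : (RamExt x)ˣ)) (by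
    have : h (v - w) (v - w) = d + star (d : RamExt x) := by
      rw [hs, hd]
      simp only [map_sub, LinearMap.sub_apply]
      linear_combination -hvw
    rw [this, star_neg]
    linear_combination (star ((d⁻¹ : (RamExt x)ˣ) : RamExt x)) * hi +
      ((d⁻¹ : (RamExt x)ˣ) : RamExt x) * hi')
  refine ⟨g, ?_⟩
  rw [hg, hd', neg_mul, Units.inv_mul]
  module

/-- Two primitive vectors of the same length are in the same orbit of the unitary group. -/
theorem exists_unitary_of_quad_eq [Finite R] [Module.Free (RamExt x) V]
    (hh : IsNondegHermitian h) (H : IsUniformizer x l) {v w : V} (hv : v ∉ yPow x V 1)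
    (hw : w ∉ yPow x V 1) (hvw : quad h v = quad h w) :
    ∃ g : unitaryGroup h, (g : V ≃ₗ[RamExt x] V) v = w := by
  have hvw' : h v v = h w w := by rw [hh.form_self H, hh.form_self H, hvw]
  by_cases h1 : IsUnit (h v v - h w v)
  · exact hh.exists_unitary_of_isUnit hvw' h1
  by_cases h2 : IsUnit (h v v + h w v)
  · obtain ⟨g, hg⟩ := hh.exists_unitary_of_isUnit (v := v) (w := -w) (by simpa using hvw')
      (by simpa using h2)
    refine ⟨scalarUnitary h (-1) (by simp) * g, ?_⟩
    change (-1 : RamExt x) • (g : V ≃ₗ[RamExt x] V) v = w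
    rw [hg]; simp
  -- Now neither v - w nor v + w is usable, so h(v, v) and h(w, v) are both non-units. The way out
  -- is an intermediate z of the same length for which both v → z and z → w are direct reflections.
  rw [← H.gen_dvd_iff_not_isUnit] at h1 h2
  have htwo : IsUnit (2 : RamExt x) := by
    have := H.two.map (algebraMap R (RamExt x))
    rwa [map_ofNat] at this
  have hc : gen x ∣ h v v := by
    rw [← htwo.dvd_mul_left]
    have := dvd_add h1 h2
    rwa [sub_add_add_cancel, ← two_mul] at this
  have hwv : gen x ∣ h w v := (dvd_add_right hc).1 h2
  have hc' : x ∣ quad h v := IsUniformizer.gen_dvd_iff.1 hc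
  -- One of u₁, u₂, u₁ + u₂ pairs to a unit with both v and w, as in covering a space by two
  -- hyperplanes.
  obtain ⟨u, huv, huw⟩ : ∃ u, h u v = 1 ∧ IsUnit (h u w) := by
    obtain ⟨u₁, hu₁⟩ := (hh.notMem_yPow_one_iff H).1 hv
    obtain ⟨u₂, hu₂⟩ := (hh.notMem_yPow_one_iff H).1 hw
    by_cases ha : IsUnit (h u₁ w)
    · exact ⟨u₁, hu₁, ha⟩
    have key : ∀ u, IsUnit (h u v) → IsUnit (h u w) → ∃ u, h u v = 1 ∧ IsUnit (h u w) := by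
      rintro u ⟨η, hη⟩ hu
      refine ⟨star (η⁻¹ : (RamExt x)ˣ).1 • u, ?_, ?_⟩
      · rw [form_smul_left, star_star, ← hη, Units.inv_mul]
      · rw [form_smul_left, star_star]
        exact (η⁻¹).isUnit.mul hu
    rw [← H.gen_dvd_iff_not_isUnit] at ha
    by_cases hb : IsUnit (h u₂ v)
    · exact key u₂ hb (hu₂ ▸ isUnit_one)
    rw [← H.gen_dvd_iff_not_isUnit] at hb
    refine key (u₁ + u₂) ?_ ?_
    · rw [map_add, LinearMap.add_apply, hu₁]
      exact H.isUnit_ext_add isUnit_one hb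
    · rw [map_add, LinearMap.add_apply, hu₂, add_comm]
      exact H.isUnit_ext_add isUnit_one ha
  -- The equation says that u + rv has length h(v, v).
  obtain ⟨r, -, hr⟩ := H.exists_quadratic (n := quad h v) (k := quad h v - quad h u)
    (hc'.mul_right _)
  have hvu : h v u = 1 := by rw [hh.symm u v, huv, star_one]
  have hwu : IsUnit (h w u) := by rw [hh.symm u w]; exact huw.star
  set z := u + algebraMap R (RamExt x) r • v with hz
  have hzz : h z z = h v v := by
    simp only [hz, map_add, LinearMap.add_apply, form_smul_left, map_smul, smul_eq_mul, huv, hvu,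
      hh.form_self H]
    ext
    · simp [QuadraticAlgebra.re_one]
      linear_combination hr
    · simp [QuadraticAlgebra.im_one]
  have hzv : IsUnit (h v v - h z v) := by
    have : h v v - h z v = -1 + (1 - star (algebraMap R (RamExt x) r)) * h v v := by
      simp only [hz, map_add, LinearMap.add_apply, form_smul_left, huv]
      ring
    rw [this]
    exact H.isUnit_ext_add isUnit_one.neg (hc.mul_left _)
  have hwz : IsUnit (h z z - h w z) := by
    have : h z z - h w z = -h w u + (h v v - algebraMap R (RamExt x) r * h w v) := by
      rw [hzz]
      simp only [hz, map_add, map_smul, smul_eq_mul]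
      ring
    rw [this]
    exact H.isUnit_ext_add hwu.neg (dvd_sub hc (hwv.mul_left _))
  obtain ⟨g₁, hg₁⟩ := hh.exists_unitary_of_isUnit hzz.symm hzv
  obtain ⟨g₂, hg₂⟩ := hh.exists_unitary_of_isUnit (hzz.trans hvw') hwz
  refine ⟨g₂ * g₁, ?_⟩
  change (g₂ : V ≃ₗ[RamExt x] V) ((g₁ : V ≃ₗ[RamExt x] V) v) = w
  rw [hg₁, hg₂]

theorem _root_.RamifiedWeil.muChar_apply (lam : AddChar R ℂ) (α : RamExt x) :
    muChar x lam α = lam (2 * α.im) := rfl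

theorem _root_.RamifiedWeil.exists_ne_one_of_isPrimitive {lam : AddChar R ℂ}
    (hlam : lam.IsPrimitive) {b : R} (hb : b ≠ 0) : ∃ c, lam (b * c) ≠ 1 := by
  obtain ⟨c, hc⟩ := (AddChar.ne_one_iff).1 (hlam hb)
  exact ⟨c, by rwa [AddChar.mulShift_apply] at hc⟩

/-- The stabilizer of a primitive vector `v` detects the vectors outside `A v + yˡ V`. -/
theorem exists_unitary_fixing [Finite R] [Module.Free (RamExt x) V]
    (hh : IsNondegHermitian h) (H : IsUniformizer x l) {lam : AddChar R ℂ}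
    (hlam : lam.IsPrimitive) {v w : V} (hv : v ∉ yPow x V 1)
    (hw : ∀ α : RamExt x, w - α • v ∉ yPow x V l) :
    ∃ g : unitaryGroup h, (g : V ≃ₗ[RamExt x] V) v = v ∧
      (g : V ≃ₗ[RamExt x] V) w - w ∈ yPow x V l ∧
      muChar x lam (h w ((g : V ≃ₗ[RamExt x] V) w - w)) ≠ 1 := by
  obtain ⟨v', hv'⟩ := (hh.notMem_yPow_one_iff H).1 hv
  have hw' := hw (h v' w)
  rw [hh.mem_yPow_iff] at hw'
  push Not at hw'
  obtain ⟨u, hu⟩ := hw'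
  -- Correcting u by a multiple of v' makes a orthogonal to v, so that reflections along a fix v.
  set a := u - star (h u v) • v' with ha
  have hav : h a v = 0 := by
    simp only [ha, map_sub, LinearMap.sub_apply, form_smul_left, star_star, hv', mul_one, sub_self]
  have haw : h a w = h u (w - h v' w • v) := by
    simp only [ha, map_sub, LinearMap.sub_apply, form_smul_left, star_star, map_smul, smul_eq_mul]
    ring
  rw [← haw] at hu
  obtain ⟨j, hj, η, hη, hjη⟩ := (H.exists_eq_gen_pow_mul (h a w) l).resolve_left hu
  have hN : (h a w).norm = (-x) ^ j * η.norm := by rw [hjη, map_mul, IsUniformizer.norm_gen_pow]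
  -- With imaginary part t = x^⌊(l-j)/2⌋c, the displacement κ h(a, w) a of w is divisible by
  -- y^(2⌊(l-j)/2⌋+1+j), hence by y^l, while μ takes the value λ(2tN(h(a, w))). The coefficient of c
  -- there has valuation ⌊(l-j)/2⌋ + j < l, so primitivity supplies a c with a non-trivial value.
  have hb : 2 * x ^ ((l - j) / 2) * (h a w).norm ≠ 0 := by
    intro hb
    have hη' : IsUnit ((-1) ^ j * η.norm) :=
      ((isUnit_one.neg).pow j).mul (hη.map QuadraticAlgebra.norm)
    have : 2 * (x ^ ((l - j) / 2 + j) * ((-1) ^ j * η.norm)) = 0 := by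
      rw [hN, neg_pow] at hb
      rw [pow_add]
      linear_combination hb
    rw [H.two.mul_right_eq_zero, hη'.mul_left_eq_zero, H.pow_eq_zero_iff] at this
    omega
  obtain ⟨c, hc⟩ := exists_ne_one_of_isPrimitive hlam hb
  obtain ⟨κ, hκ, ⟨κ', hκ'⟩, g, hg⟩ := hh.exists_reflection_im H a (x ^ ((l - j) / 2) * c)
  refine ⟨g, ?_, ?_, ?_⟩
  · rw [hg, hav, mul_zero, zero_smul, add_zero]
  · rw [hg, add_sub_cancel_left]
    refine smul_mem_yPow ?_ a
    have : gen x ^ (2 * ((l - j) / 2) + 1 + j) ∣ κ * h a w := by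
      refine ⟨algebraMap R (RamExt x) c * κ' * η, ?_⟩
      rw [pow_add, pow_add, IsUniformizer.gen_pow_two_mul, pow_one, hκ', hjη, map_mul]
      ring
    exact (pow_dvd_pow _ (by omega)).trans this
  · rw [hg, add_sub_cancel_left, map_smul, smul_eq_mul, hh.symm a w, mul_assoc,
      ← QuadraticAlgebra.algebraMap_norm_eq_mul_star, muChar_apply]
    rw [show (κ * algebraMap R (RamExt x) (h a w).norm).im = κ.im * (h a w).norm by simp, hκ]
    rwa [show 2 * (x ^ ((l - j) / 2) * c * (h a w).norm) =
      2 * x ^ ((l - j) / 2) * (h a w).norm * c by ring]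

/-- The stabilizer of `v + yˡ V` detects scalars of the line through `v`. -/
theorem exists_unitary_scaling [Finite R] [Module.Free (RamExt x) V]
    (hh : IsNondegHermitian h) (H : IsUniformizer x l) {lam : AddChar R ℂ}
    (hlam : lam.IsPrimitive) {v : V} (hv : v ∉ yPow x V 1) {s : R}
    (hs : ¬ x ^ (l - l / 2) ∣ s) :
    ∃ g : unitaryGroup h, (g : V ≃ₗ[RamExt x] V) v - v ∈ yPow x V l ∧
      muChar x lam (algebraMap R (RamExt x) s * h v ((g : V ≃ₗ[RamExt x] V) v - v)) ≠ 1 := by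
  obtain ⟨v', hv'⟩ := (hh.notMem_yPow_one_iff H).1 hv
  -- A reflection along v' with imaginary part x^⌊l/2⌋c moves v by κv', and y^(2⌊l/2⌋+1) divides κ,
  -- so v stays in v + y^l V. The character value is λ(2x^⌊l/2⌋sc), and x^⌊l/2⌋s ≠ 0 is precisely
  -- the hypothesis on s.
  have hb : 2 * (x ^ (l / 2) * s) ≠ 0 := by
    rwa [Ne, H.two.mul_right_eq_zero, H.pow_mul_eq_zero_iff (Nat.div_le_self l 2)]
  obtain ⟨c, hc⟩ := exists_ne_one_of_isPrimitive hlam hb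
  obtain ⟨κ, hκ, ⟨κ', hκ'⟩, g, hg⟩ := hh.exists_reflection_im H v' (x ^ (l / 2) * c)
  refine ⟨g, ?_, ?_⟩
  · rw [hg, add_sub_cancel_left, hv', mul_one]
    refine smul_mem_yPow ?_ v'
    have : gen x ^ (2 * (l / 2) + 1) ∣ κ := by
      refine ⟨algebraMap R (RamExt x) c * κ', ?_⟩
      rw [pow_add, IsUniformizer.gen_pow_two_mul, pow_one, hκ', map_mul]
      ring
    exact (pow_dvd_pow _ (by omega)).trans this
  · rw [hg, add_sub_cancel_left, hv', mul_one, map_smul, hh.symm v' v, hv', star_one, smul_eq_mul,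
      mul_one, muChar_apply]
    rw [show (algebraMap R (RamExt x) s * κ).im = s * κ.im by simp, hκ]
    rwa [show 2 * (s * (x ^ (l / 2) * c)) = 2 * (x ^ (l / 2) * s) * c by ring]

end IsNondegHermitian

end Hermitian

/-! ### Coordinates on the Weil module. -/

section Coefficients

variable {R : Type*} [CommRing R] {x : R} {V : Type*} [AddCommGroup V]
  [Module (RamExt x) V] (h : V →ₗ⋆[RamExt x] V →ₗ[RamExt x] RamExt x) (lam : AddChar R ℂ)
  {l : ℕ} (hl : x ^ l = 0)

open Classical in
/-- The inverse of `polarChar`, extended by zero. -/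
noncomputable def polarFun (k : HeisU h) : ℂ :=
  if hk : k ∈ polarSubgroup h l then polarChar h lam hl ⟨k, hk⟩⁻¹ else 0

/-- This covariance lets the functional descend to the coinvariants that define the induced module.
-/
theorem polarFun_mul (p : polarSubgroup h l) (k : HeisU h) :
    polarFun h lam hl (p * k) * polarChar h lam hl p = polarFun h lam hl k := by
  by_cases hk : k ∈ polarSubgroup h l
  · have hpk : (p : HeisU h) * k ∈ polarSubgroup h l := mul_mem p.2 hk
    rw [polarFun, polarFun, dif_pos hk, dif_pos hpk, ← map_mul]
    congr 1
    rw [show (⟨p * k, hpk⟩ : polarSubgroup h l) = p * ⟨k, hk⟩ from rfl, mul_inv_rev,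
      inv_mul_cancel_right]
  · have hpk : (p : HeisU h) * k ∉ polarSubgroup h l := by
      rwa [Subgroup.mul_mem_cancel_left _ p.2]
    rw [polarFun, polarFun, dif_neg hk, dif_neg hpk, zero_mul]

/-- The linear functional on the induced module that reads off the coefficient of `ζ`. -/
noncomputable def baseCoeff : WeilSpace h lam hl →ₗ[ℂ] ℂ :=
  Representation.Coinvariants.lift _
    (TensorProduct.lift (LinearMap.lsmul ℂ ℂ ∘ₗ
      (Finsupp.linearCombination ℂ (polarFun h lam hl) ∘ₗ
        (MonoidAlgebra.coeffLinearEquiv ℂ).toLinearMap)))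
    (by
      intro p
      refine TensorProduct.ext (MonoidAlgebra.lhom_ext' fun k => LinearMap.ext_ring ?_)
      refine LinearMap.ext_ring ?_
      have := polarFun_mul h lam hl p k
      simpa [polarRep, MonoidAlgebra.coeffLinearEquiv] using this)

theorem baseCoeff_mk (k : HeisU h) (a : ℂ) :
    baseCoeff h lam hl (Representation.IndV.mk (polarSubgroup h l).subtype (polarRep h lam hl) k a)
      = polarFun h lam hl k * a := by
  simp [baseCoeff, MonoidAlgebra.coeffLinearEquiv]

theorem heisURep_polar (p : polarSubgroup h l) :
    heisURep h lam hl p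
        (Representation.IndV.mk (polarSubgroup h l).subtype (polarRep h lam hl) 1 1) =
      polarChar h lam hl p •
        Representation.IndV.mk (polarSubgroup h l).subtype (polarRep h lam hl) 1 1 := by
  rw [heisURep, Representation.ind_mk, one_mul]
  have h1 : polarRep h lam hl p⁻¹ (polarChar h lam hl p) = 1 := by
    change polarChar h lam hl p⁻¹ * polarChar h lam hl p = 1
    rw [← map_mul, inv_mul_cancel, map_one]
  have h2 := Representation.Coinvariants.mk_self_apply
    (Representation.tprod ((Representation.leftRegular ℂ (HeisU h)).comp
      (polarSubgroup h l).subtype) (polarRep h lam hl)) p⁻¹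
    (TensorProduct.tmul ℂ (MonoidAlgebra.single 1 1) (polarChar h lam hl p))
  rw [Representation.tprod_apply, TensorProduct.map_tmul, h1] at h2
  rw [← map_smul, smul_eq_mul, mul_one]
  simpa using h2

theorem muChar_mul_neg (α : RamExt x) : muChar x lam α * muChar x lam (-α) = 1 := by
  rw [← AddChar.map_add_eq_mul, add_neg_cancel, AddChar.map_zero_eq_one]

theorem muChar_ne_zero (α : RamExt x) : muChar x lam α ≠ 0 :=
  left_ne_zero_of_mul_eq_one (muChar_mul_neg lam α)

/-- In the Heisenberg group (0, v + u) = (0, v)(-h(v, u), u), and the second factor acts on ζ by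
μ(-h(v, u)). -/
theorem weilVec_add (v : V) {u : V} (hu : u ∈ yPow x V l) :
    weilVec h lam hl (v + u) = muChar x lam (-h v u) • weilVec h lam hl v := by
  have hmul : (SemidirectProduct.inl ⟨0, v + u⟩ : HeisU h) =
      SemidirectProduct.inl ⟨0, v⟩ * SemidirectProduct.inl ⟨-h v u, u⟩ := by
    rw [← map_mul]
    congr 1
    ext <;> simp
  let p : polarSubgroup h l := ⟨SemidirectProduct.inl ⟨-h v u, u⟩, hu⟩
  rw [weilVec, hmul, map_mul, Module.End.mul_apply]
  have := heisURep_polar h lam hl p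
  rw [show heisURep h lam hl (SemidirectProduct.inl ⟨-h v u, u⟩) _ = _ from this, map_smul]
  rfl

theorem weilVec_of_sub_mem {v w : V} (hu : w - v ∈ yPow x V l) :
    weilVec h lam hl w = muChar x lam (-h v (w - v)) • weilVec h lam hl v := by
  rw [← weilVec_add h lam hl v hu, add_sub_cancel]

/-- The coefficient of `e_w`. -/
noncomputable def weilCoeff (w : V) : WeilSpace h lam hl →ₗ[ℂ] ℂ :=
  baseCoeff h lam hl ∘ₗ heisURep h lam hl (SemidirectProduct.inl ⟨0, w⟩)⁻¹

-- The coefficient functionals detect the coset of v modulo V₀; this gives linear independence of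
-- the e_v for distinct cosets. The phase is inverse to the one in `weilVec_of_sub_mem`.
open Classical in
theorem weilCoeff_weilVec (w v : V) : weilCoeff h lam hl w (weilVec h lam hl v) =
    if w - v ∈ yPow x V l then muChar x lam (h v (w - v)) else 0 := by
  have hk : ((SemidirectProduct.inl (⟨0, w⟩ : Heisenberg h) : HeisU h)⁻¹ *
      SemidirectProduct.inl ⟨0, v⟩)⁻¹ = SemidirectProduct.inl ⟨-h v (w - v), w - v⟩ := by
    rw [mul_inv_rev, inv_inv, ← map_inv, ← map_mul]
    congr 1
    ext1
    · simp; ring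
    · simp; abel
  rw [weilCoeff, LinearMap.comp_apply, weilVec, ← Module.End.mul_apply, ← map_mul, heisURep,
    Representation.ind_mk, baseCoeff_mk, one_mul, mul_one, hk, polarFun]
  by_cases hw : w - v ∈ yPow x V l
  · rw [if_pos hw, dif_pos (show _ ∈ polarSubgroup h l from hw)]
    have h1 := muChar_mul_neg lam (h v (w - v))
    have h2 : polarChar h lam hl ⟨SemidirectProduct.inl ⟨-h v (w - v), w - v⟩, hw⟩ =
      muChar x lam (-h v (w - v)) := rfl
    have h3 : polarChar h lam hl ⟨SemidirectProduct.inl ⟨-h v (w - v), w - v⟩, hw⟩⁻¹ *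
        polarChar h lam hl ⟨SemidirectProduct.inl ⟨-h v (w - v), w - v⟩, hw⟩ = 1 := by
      rw [← map_mul, inv_mul_cancel, map_one]
    rw [h2] at h3
    exact mul_right_cancel₀ (muChar_ne_zero lam _) (h3.trans h1.symm)
  · rw [if_neg hw, dif_neg (show _ ∉ polarSubgroup h l from hw)]

/-- The span of the vectors `e_v`. -/
noncomputable def weilSpan : Submodule ℂ (WeilSpace h lam hl) :=
  Submodule.span ℂ (Set.range (weilVec h lam hl))

theorem top_le_weilSpan : (top h lam hl).toSubmodule ≤ weilSpan h lam hl :=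
  Submodule.span_mono (Set.image_subset_range _ _)

variable {h lam hl}

/-- Two linear maps agreeing on all `e_v` agree on their span. -/
theorem eq_of_mem_weilSpan {M : Type*} [AddCommGroup M] [Module ℂ M]
    {F G : WeilSpace h lam hl →ₗ[ℂ] M} (hFG : ∀ v, F (weilVec h lam hl v) = G (weilVec h lam hl v))
    {f : WeilSpace h lam hl} (hf : f ∈ weilSpan h lam hl) : F f = G f := by
  refine LinearMap.eqOn_span ?_ hf
  rintro _ ⟨v, rfl⟩
  exact hFG v

theorem weilCoeff_unitary (g : unitaryGroup h) (w : V) {f : WeilSpace h lam hl}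
    (hf : f ∈ weilSpan h lam hl) :
    weilCoeff h lam hl ((g : V ≃ₗ[RamExt x] V) w) (weilRep h lam hl g f) =
      weilCoeff h lam hl w f := by
  refine eq_of_mem_weilSpan (F := weilCoeff h lam hl _ ∘ₗ weilRep h lam hl g) (fun v => ?_) hf
  classical
  have hiff : (g : V ≃ₗ[RamExt x] V) (w - v) ∈ yPow x V l ↔ w - v ∈ yPow x V l := by
    constructor
    · rintro ⟨z, hz⟩
      refine ⟨(g : V ≃ₗ[RamExt x] V).symm z, (g : V ≃ₗ[RamExt x] V).injective ?_⟩
      rw [← hz]; simp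
    · rintro ⟨z, hz⟩
      exact ⟨(g : V ≃ₗ[RamExt x] V) z, by rw [← hz]; simp⟩
  rw [LinearMap.comp_apply, weilRep_weilVec, weilCoeff_weilVec, weilCoeff_weilVec, ← map_sub,
    g.2 v (w - v)]
  simp only [hiff]

theorem weilCoeff_add (w : V) {u : V} (hu : u ∈ yPow x V l) {f : WeilSpace h lam hl}
    (hf : f ∈ weilSpan h lam hl) :
    weilCoeff h lam hl (w + u) f = muChar x lam (h w u) * weilCoeff h lam hl w f := by
  refine eq_of_mem_weilSpan (G := muChar x lam (h w u) • weilCoeff h lam hl w) (fun v => ?_) hf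
  classical
  rw [LinearMap.smul_apply, weilCoeff_weilVec, weilCoeff_weilVec, add_sub_right_comm,
    Submodule.add_mem_iff_left _ hu]
  split_ifs with hw
  · have h1 : h (w - v) u = 0 := form_yPow h hl hw hu
    rw [smul_eq_mul, ← AddChar.map_add_eq_mul, map_add, add_comm]
    congr 2
    rw [map_sub, LinearMap.sub_apply] at h1
    exact (sub_eq_zero.1 h1).symm
  · rw [smul_zero]

/-- Summing over all of V avoids choosing representatives: the phases of coefficient and vector
cancel within a coset of V₀, so each coset contributes |V₀| equal terms. -/
theorem sum_weilCoeff_smul [Fintype V] {f : WeilSpace h lam hl} (hf : f ∈ weilSpan h lam hl) :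
    ∑ w, weilCoeff h lam hl w f • weilVec h lam hl w = (Nat.card (yPow x V l) : ℂ) • f := by
  classical
  have key := eq_of_mem_weilSpan
    (F := ∑ w, (weilCoeff h lam hl w).smulRight (weilVec h lam hl w))
    (G := (Nat.card (yPow x V l) : ℂ) • LinearMap.id) (fun v => ?_) hf
  · simpa [LinearMap.sum_apply] using key
  · rw [LinearMap.sum_apply, LinearMap.smul_apply, LinearMap.id_apply]
    have : ∀ w, (weilCoeff h lam hl w).smulRight (weilVec h lam hl w) (weilVec h lam hl v) =
        if w - v ∈ yPow x V l then weilVec h lam hl v else 0 := by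
      intro w
      rw [LinearMap.smulRight_apply, weilCoeff_weilVec]
      split_ifs with hw
      · rw [weilVec_of_sub_mem h lam hl hw, smul_smul, muChar_mul_neg, one_smul]
      · rw [zero_smul]
    simp_rw [this]
    rw [← Finset.sum_filter, Finset.sum_const, ← Nat.cast_smul_eq_nsmul ℂ]
    congr 2
    rw [← Fintype.card_subtype, ← Nat.card_eq_fintype_card]
    exact Nat.card_congr ((Equiv.subRight v).subtypeEquiv fun w => Iff.rfl)

end Coefficients

/-! ### Support of a vector that transforms like e_v. -/

namespace IsUniformizer

variable {R : Type*} [CommRing R] {x : R} {l : ℕ}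

theorem sub_div_two_pos (H : IsUniformizer x l) : 1 ≤ l - l / 2 := by
  have := H.pos
  omega

theorem gen_pow_dvd_algebraMap {r : R} (hr : x ^ (l - l / 2) ∣ r) :
    gen x ^ l ∣ algebraMap R (RamExt x) r := by
  rw [gen_pow_dvd_iff]
  simpa using hr

/-- An element whose norm is close to `1` is close to an element of norm `1`. -/
theorem exists_norm_one_of_dvd [Finite R] (H : IsUniformizer x l) {α : RamExt x}
    (hα : x ^ (l - l / 2) ∣ α.norm - 1) :
    ∃ z : RamExt x, z * star z = 1 ∧ gen x ^ l ∣ α - z := by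
  obtain ⟨s, hs, h2⟩ := H.exists_sq_eq_one_add
    ((dvd_pow_self x (by have := H.sub_div_two_pos; omega)).trans hα)
  obtain ⟨v, hv⟩ := H.isUnit_add H.two hs
  have hs' : x ^ (l - l / 2) ∣ s := by
    rw [← (v.isUnit).dvd_mul_right, hv]
    rwa [show s * (2 + s) = α.norm - 1 by linear_combination h2]
  obtain ⟨u, hu⟩ := H.isUnit_add isUnit_one hs
  have hi : (u : R) * (u⁻¹ : Rˣ) = 1 := u.mul_inv
  -- Divide α by the square root u = 1 + s of its norm; then α - z = sz, and x^⌈l/2⌉ ∣ s because s(2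
  -- + s) = N(α) - 1.
  refine ⟨α * algebraMap R (RamExt x) (u⁻¹ : Rˣ), ?_, ?_⟩
  · rw [← QuadraticAlgebra.algebraMap_norm_eq_mul_star, map_mul, QuadraticAlgebra.norm_algebraMap,
      show α.norm = u ^ 2 by rw [hu, h2]; ring, ← mul_pow, hi, one_pow, map_one]
  · have : α - α * algebraMap R (RamExt x) (u⁻¹ : Rˣ) =
        algebraMap R (RamExt x) s * (α * algebraMap R (RamExt x) (u⁻¹ : Rˣ)) := by
      have h3 : s * (u⁻¹ : Rˣ) = 1 - (u⁻¹ : Rˣ) := by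
        rw [show s = u - 1 by rw [hu]; ring]
        linear_combination hi
      rw [mul_left_comm, ← map_mul, h3, map_sub, map_one]
      ring
    rw [this]
    exact (gen_pow_dvd_algebraMap hs').mul_right _

end IsUniformizer

section Endomorphisms

variable {R : Type*} [CommRing R] {x : R} {V : Type*} [AddCommGroup V]
  [Module (RamExt x) V] {h : V →ₗ⋆[RamExt x] V →ₗ[RamExt x] RamExt x} {lam : AddChar R ℂ}
  {l : ℕ}

theorem IsNondegHermitian.gen_pow_dvd_of_smul_mem [Module.Free (RamExt x) V]
    (hh : IsNondegHermitian h) (H : IsUniformizer x l) {v : V} (hv : v ∉ yPow x V 1)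
    {α : RamExt x} {j : ℕ} (hα : α • v ∈ yPow x V j) : gen x ^ j ∣ α := by
  obtain ⟨u, hu⟩ := (hh.notMem_yPow_one_iff H).1 hv
  have := gen_pow_dvd_form (h := h) hα u
  rwa [map_smul, hu, smul_eq_mul, mul_one] at this

theorem IsNondegHermitian.notMem_of_sub_mem (H : IsUniformizer x l) {v w : V}
    (hv : v ∉ yPow x V 1) (hwv : w - v ∈ yPow x V l) : w ∉ yPow x V 1 := by
  intro hw
  refine hv ?_
  rw [← sub_sub_cancel w v]
  exact sub_mem hw (yPow_le H.pos hwv)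

/-- The quadratic term vanishes on V₀, and the cross term is a trace from y^l A, which lies in
x^⌈l/2⌉R. -/
theorem IsNondegHermitian.dvd_quad_sub (hh : IsNondegHermitian h) (hl : x ^ l = 0) {v w : V}
    (hwv : w - v ∈ yPow x V l) : x ^ (l - l / 2) ∣ quad h w - quad h v := by
  have h1 : h (w - v) (w - v) = 0 := form_yPow h hl hwv hwv
  have h2 : h w w = h v v + (h v (w - v) + star (h v (w - v))) := by
    rw [← hh.symm v (w - v)]
    simp only [map_sub, LinearMap.sub_apply] at h1 ⊢
    linear_combination h1
  have h3 := ((IsUniformizer.gen_pow_dvd_iff l).1 (gen_pow_dvd_form (h := h) hwv v)).1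
  have h4 := ((IsUniformizer.gen_pow_dvd_iff l).1
    (IsUniformizer.gen_pow_dvd_star (gen_pow_dvd_form (h := h) hwv v))).1
  rw [quad, quad, h2, QuadraticAlgebra.re_add, add_sub_cancel_left, QuadraticAlgebra.re_add]
  exact dvd_add h3 h4

/-- With h(u, w) = 1, the length of w + ru is h(w, w) + 2r + h(u, u)r², so a prescribed small change
of length is a solvable quadratic equation in r. -/
theorem IsNondegHermitian.exists_quad_eq [Finite R] [Module.Free (RamExt x) V]
    (hh : IsNondegHermitian h) (H : IsUniformizer x l) {w : V} (hw : w ∉ yPow x V 1) {c : R}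
    {j : ℕ} (hj : 1 ≤ j) (hc : x ^ j ∣ c - quad h w) :
    ∃ r u, x ^ j ∣ r ∧ quad h (w + algebraMap R (RamExt x) r • u) = c := by
  obtain ⟨u, hu⟩ := (hh.notMem_yPow_one_iff H).1 hw
  have hu' : h w u = 1 := by rw [hh.symm u w, hu, star_one]
  obtain ⟨r, hr, h2⟩ := H.exists_quadratic (n := quad h u) (k := c - quad h w)
    (((dvd_pow_self x (by omega)).trans hc).mul_left _)
  refine ⟨r, u, hc.trans hr, ?_⟩
  have : h (w + algebraMap R (RamExt x) r • u) (w + algebraMap R (RamExt x) r • u) =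
      h w w + (algebraMap R (RamExt x) r + star (algebraMap R (RamExt x) r)) +
        algebraMap R (RamExt x) r * star (algebraMap R (RamExt x) r) * h u u := by
    simp only [map_add, LinearMap.add_apply, form_smul_left, map_smul, smul_eq_mul, hu, hu']
    ring
  rw [quad, this, hh.form_self H, hh.form_self H]
  simp
  linear_combination h2

/-- A vector of `Top` transforming under the stabilizer of the line of `e_v` like `e_v` is supported
on the multiples of `v` by scalars of norm one. -/
theorem IsNondegHermitian.exists_scalar_of_weilCoeff_ne_zero [Finite R] [Module.Free (RamExt x) V]
    (hh : IsNondegHermitian h) (H : IsUniformizer x l) (hlam : lam.IsPrimitive) {v : V}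
    (hv : v ∉ yPow x V 1) {f : WeilSpace h lam H.pow} (hf : f ∈ weilSpan h lam H.pow)
    (hvf : ∀ (g : unitaryGroup h) (c : ℂ), weilRep h lam H.pow g (weilVec h lam H.pow v) =
      c • weilVec h lam H.pow v → weilRep h lam H.pow g f = c • f) {w : V}
    (hw : weilCoeff h lam H.pow w f ≠ 0) :
    ∃ z : RamExt x, z * star z = 1 ∧ w - z • v ∈ yPow x V l := by
  obtain ⟨α, hα⟩ : ∃ α : RamExt x, w - α • v ∈ yPow x V l := by
    by_contra! hα
    obtain ⟨g, hgv, hgw, hne⟩ := hh.exists_unitary_fixing H hlam hv hα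
    have h1 := hvf g 1 (by rw [weilRep_weilVec, hgv, one_smul])
    have h2 := weilCoeff_unitary g w hf
    rw [h1, one_smul, ← add_sub_cancel w ((g : V ≃ₗ[RamExt x] V) w), weilCoeff_add w hgw hf] at h2
    exact hne (mul_right_cancel₀ hw (h2.trans (one_mul _).symm))
  have hw' : weilCoeff h lam H.pow (α • v) f ≠ 0 := by
    intro h0
    apply hw
    rw [← add_sub_cancel (α • v) w, weilCoeff_add _ hα hf, h0, mul_zero]
  have hnorm : x ^ (l - l / 2) ∣ α.norm - 1 := by
    -- Here g multiplies e_v by μ(-h(v, gv - v)), while moving αv to gαv costs the phase μ(N(α)h(v,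
    -- gv - v)). Equality of the two forces μ((N(α) - 1)h(v, gv - v)) = 1.
    by_contra hs
    obtain ⟨g, hgv, hne⟩ := hh.exists_unitary_scaling H hlam hv hs
    have h1 := hvf g (muChar x lam (-h v ((g : V ≃ₗ[RamExt x] V) v - v)))
      (by rw [weilRep_weilVec, weilVec_of_sub_mem h lam H.pow hgv])
    have h2 := weilCoeff_unitary g (α • v) hf
    have hgv' : α • ((g : V ≃ₗ[RamExt x] V) v - v) ∈ yPow x V l :=
      Submodule.smul_mem _ _ hgv
    rw [h1, map_smul, show (g : V ≃ₗ[RamExt x] V) (α • v) =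
      α • v + α • ((g : V ≃ₗ[RamExt x] V) v - v) by rw [map_smul, smul_sub, add_sub_cancel],
      weilCoeff_add _ hgv' hf, smul_eq_mul, ← mul_assoc, ← AddChar.map_add_eq_mul] at h2
    have h3 := mul_right_cancel₀ hw' (h2.trans (one_mul _).symm)
    refine hne ?_
    rw [← h3]
    congr 1
    rw [form_smul_left, map_smul, smul_eq_mul, map_sub, map_one,
      QuadraticAlgebra.algebraMap_norm_eq_mul_star]
    ring
  obtain ⟨z, hz, hαz⟩ := H.exists_norm_one_of_dvd hnorm
  refine ⟨z, hz, ?_⟩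
  rw [show w - z • v = (w - α • v) + (α - z) • v by module]
  exact add_mem hα (smul_mem_yPow hαz v)

end Endomorphisms

/-! ### Commutativity and dimension of intertwining algebras. -/

theorem mem_span_of_coe_mem_span {X I : Type*} [AddCommGroup X] [Module ℂ X] {p : Submodule ℂ X}
    {u : I → p} {f : p} (hf : (f : X) ∈ Submodule.span ℂ (Set.range fun i => (u i : X))) :
    f ∈ Submodule.span ℂ (Set.range u) := by
  have h1 : Submodule.span ℂ (Set.range fun i => (u i : X)) =
      (Submodule.span ℂ (Set.range u)).map p.subtype := by
    rw [Submodule.map_span, ← Set.range_comp]; rfl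
  rw [h1] at hf
  obtain ⟨g, hg, hgf⟩ := hf
  rwa [← Subtype.ext hgf]

section Intertwiners

variable {G W P : Type*} [Group G] [AddCommGroup W] [Module ℂ W] {τ : Representation ℂ G W}
  {t : P → W}

theorem intertwiner_ext (ht : Submodule.span ℂ (Set.range t) = ⊤) {S T : τ.IntertwiningMap τ}
    (hST : ∀ v, S (t v) = T (t v)) : S = T :=
  Representation.IntertwiningMap.ext (LinearMap.ext_on_range ht hST)

/-- If the vectors `t v` span a representation and every intertwiner maps `t v` into the span of
its translates by a commuting family of group elements, then all intertwiners commute. -/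
theorem intertwiner_comm (ht : Submodule.span ℂ (Set.range t) = ⊤) {Z : Type*} {σ : Z → G}
    (hσ : ∀ z z', σ z * σ z' = σ z' * σ z)
    (hspan : ∀ (T : τ.IntertwiningMap τ) (v : P),
      T (t v) ∈ Submodule.span ℂ (Set.range fun z => τ (σ z) (t v)))
    (S T : τ.IntertwiningMap τ) : S * T = T * S := by
  refine intertwiner_ext ht fun v => ?_
  change S (T (t v)) = T (S (t v))
  obtain ⟨b, hb⟩ := (Finsupp.mem_span_range_iff_exists_finsupp).1 (hspan S v)
  obtain ⟨c, hc⟩ := (Finsupp.mem_span_range_iff_exists_finsupp).1 (hspan T v)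
  have h1 : S (T (t v)) = c.sum fun i a => b.sum fun j a' => (a * a') • τ (σ i * σ j) (t v) := by
    rw [← hc, ← S.toLinearMap_apply, map_finsuppSum]
    refine Finset.sum_congr rfl fun i _ => ?_
    simp only
    rw [map_smul, S.toLinearMap_apply, S.isIntertwining, ← hb, map_finsuppSum, Finsupp.smul_sum]
    refine Finset.sum_congr rfl fun j _ => ?_
    simp only
    rw [map_smul, smul_smul, map_mul, Module.End.mul_apply]
  have h2 : T (S (t v)) = b.sum fun j a' => c.sum fun i a => (a' * a) • τ (σ j * σ i) (t v) := by
    rw [← hb, ← T.toLinearMap_apply, map_finsuppSum]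
    refine Finset.sum_congr rfl fun i _ => ?_
    simp only
    rw [map_smul, T.toLinearMap_apply, T.isIntertwining, ← hc, map_finsuppSum, Finsupp.smul_sum]
    refine Finset.sum_congr rfl fun j _ => ?_
    simp only
    rw [map_smul, smul_smul, map_mul, Module.End.mul_apply]
  rw [h1, h2, Finsupp.sum_comm]
  refine Finset.sum_congr rfl fun j _ => Finset.sum_congr rfl fun i _ => ?_
  simp only
  rw [mul_comm (c i), hσ]

/-- The dimension of an intertwining algebra, given representatives `r d` of the orbits of lines
spanned by the `t v`, a basis `u d i` of the possible images of `t (r d)`, and intertwiners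
realizing these images. -/
theorem finrank_intertwiner (ht : Submodule.span ℂ (Set.range t) = ⊤) {D I : Type*} [Fintype D]
    [Fintype I] (r : D → P) (hr : ∀ v, ∃ (d : D) (g : G) (c : ℂ), t v = c • τ g (t (r d)))
    (u : D → I → W) (hspan : ∀ (T : τ.IntertwiningMap τ) (d : D),
      T (t (r d)) ∈ Submodule.span ℂ (Set.range (u d)))
    (hu : ∀ d, LinearIndependent ℂ (u d))
    (hex : ∀ d i, ∃ T : τ.IntertwiningMap τ, T (t (r d)) = u d i ∧
      ∀ d', d' ≠ d → T (t (r d')) = 0) :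
    Module.finrank ℂ (τ.IntertwiningMap τ) = Fintype.card D * Fintype.card I := by
  classical
  choose T hT hT' using hex
  let F : (D × I → ℂ) →ₗ[ℂ] τ.IntertwiningMap τ := Fintype.linearCombination ℂ fun p => T p.1 p.2
  have hF : ∀ a d, F a (t (r d)) = ∑ i, a (d, i) • u d i := by
    intro a d
    rw [Fintype.linearCombination_apply, Representation.IntertwiningMap.sum_apply,
      Fintype.sum_prod_type, Finset.sum_eq_single d]
    · refine Finset.sum_congr rfl fun i _ => ?_
      rw [← hT]; rfl
    · intro d' _ hd'
      refine Finset.sum_eq_zero fun i _ => ?_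
      change a (d', i) • T d' i (t (r d)) = 0
      rw [hT' d' i d hd'.symm, smul_zero]
    · simp
  have hzero : ∀ S S' : τ.IntertwiningMap τ, (∀ d, S (t (r d)) = S' (t (r d))) → S = S' := by
    intro S S' hS
    refine intertwiner_ext ht fun v => ?_
    obtain ⟨d, g, c, hv⟩ := hr v
    rw [hv, ← S.toLinearMap_apply, ← S'.toLinearMap_apply, map_smul, map_smul,
      S.toLinearMap_apply, S'.toLinearMap_apply, S.isIntertwining, S'.isIntertwining, hS]
  have hinj : Function.Injective F := by
    rw [← LinearMap.ker_eq_bot, LinearMap.ker_eq_bot']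
    intro a ha
    funext p
    have h1 := hF a p.1
    rw [ha] at h1
    exact Fintype.linearIndependent_iff.1 (hu p.1) (fun i => a (p.1, i)) h1.symm p.2
  have hsurj : Function.Surjective F := by
    intro S
    have h1 : ∀ d, ∃ a : I → ℂ, ∑ i, a i • u d i = S (t (r d)) := fun d =>
      (Submodule.mem_span_range_iff_exists_fun ℂ).1 (hspan S d)
    choose a ha using h1
    exact ⟨fun p => a p.1 p.2, hzero _ _ fun d => by rw [hF, ha]⟩
  rw [← (LinearEquiv.ofBijective F ⟨hinj, hsurj⟩).finrank_eq, Module.finrank_fintype_fun_eq_card,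
    Fintype.card_prod]

end Intertwiners

section Subrepresentation

theorem representation_comm_apply {G X : Type*} [Group G] [AddCommGroup X] [Module ℂ X]
    (ρ : Representation ℂ G X) {a b : G} (hab : a * b = b * a) (f : X) :
    ρ a (ρ b f) = ρ b (ρ a f) := by
  rw [← Module.End.mul_apply, ← Module.End.mul_apply, ← map_mul, ← map_mul, hab]

variable {G X P Z : Type*} [Group G] [AddCommGroup X] [Module ℂ X] {ρ : Representation ℂ G X}
  (σ : Subrepresentation ρ) {e : P → X}

/-- `f` transforms under the stabilizer of the line of `w` as `w` does. -/
def TransformsLike (ρ : Representation ℂ G X) (w f : X) : Prop :=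
  ∀ (g : G) (c : ℂ), ρ g w = c • w → ρ g f = c • f

theorem transformsLike_intertwiner
    (T : σ.toRepresentation.IntertwiningMap σ.toRepresentation) (w : σ.toSubmodule) :
    TransformsLike ρ w (T w) := by
  intro g c hgc
  have h1 : σ.toRepresentation g w = c • w := Subtype.ext hgc
  have h2 : T.toLinearMap (σ.toRepresentation g w) = σ.toRepresentation g (T.toLinearMap w) :=
    LinearMap.congr_fun (T.isIntertwining' g) w
  rw [h1, map_smul] at h2
  exact (congrArg Subtype.val h2).symm

theorem span_eq_top_of_coe (hσ : σ.toSubmodule = Submodule.span ℂ (Set.range e))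
    (he : ∀ v, e v ∈ σ.toSubmodule) :
    Submodule.span ℂ (Set.range fun v => (⟨e v, he v⟩ : σ.toSubmodule)) = ⊤ := by
  refine eq_top_iff.2 fun f _ => mem_span_of_coe_mem_span ?_
  exact hσ.le f.2

/-- A criterion for a finitely spanned subrepresentation to be multiplicity-free, with a count of
its irreducible constituents. -/
theorem numConstituents_and_length_of_span [Finite G] [Finite P]
    (hσ : σ.toSubmodule = Submodule.span ℂ (Set.range e))
    {s : Z → G} (hs : ∀ z z', s z * s z' = s z' * s z)
    (hspan : ∀ v, ∀ f ∈ σ.toSubmodule, TransformsLike ρ (e v) f →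
      f ∈ Submodule.span ℂ (Set.range fun z => ρ (s z) (e v)))
    {D I : Type*} [Finite D] [Finite I] (r : D → P)
    (hr : ∀ v, ∃ (d : D) (g : G) (c : ℂ), e v = c • ρ g (e (r d))) (z : I → Z)
    (hz : ∀ d w, ∃ (i : I) (c : ℂ), ρ (s w) (e (r d)) = c • ρ (s (z i)) (e (r d)))
    (hu : ∀ d, LinearIndependent ℂ fun i => ρ (s (z i)) (e (r d)))
    (hex : ∀ d i, ∃ (Q : X →ₗ[ℂ] X) (c : ℂ), c ≠ 0 ∧ (∀ f ∈ σ.toSubmodule, Q f ∈ σ.toSubmodule) ∧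
      (∀ g, ∀ f ∈ σ.toSubmodule, Q (ρ g f) = ρ g (Q f)) ∧
      Q (e (r d)) = c • ρ (s (z i)) (e (r d)) ∧ ∀ d', d' ≠ d → Q (e (r d')) = 0) :
    numConstituents σ.toRepresentation = Nat.card D * Nat.card I ∧
      lengthOf σ.toRepresentation = (Nat.card D * Nat.card I : ℕ) := by
  have := Fintype.ofFinite D
  have := Fintype.ofFinite I
  have he : ∀ v, e v ∈ σ.toSubmodule := fun v => hσ ▸ Submodule.subset_span ⟨v, rfl⟩
  have ht := span_eq_top_of_coe σ hσ he
  have : FiniteDimensional ℂ σ.toSubmodule := by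
    rw [hσ]
    exact FiniteDimensional.span_of_finite ℂ (Set.finite_range e)
  have hcomm : ∀ S T : σ.toRepresentation.IntertwiningMap σ.toRepresentation, S * T = T * S :=
    intertwiner_comm ht hs fun T v => mem_span_of_coe_mem_span <|
      hspan v _ (T ⟨e v, he v⟩).2 (transformsLike_intertwiner σ T ⟨e v, he v⟩)
  have hrank : Module.finrank ℂ (σ.toRepresentation.IntertwiningMap σ.toRepresentation) =
      Nat.card D * Nat.card I := by
    rw [Nat.card_eq_fintype_card, Nat.card_eq_fintype_card]
    refine finrank_intertwiner ht r (fun v => ?_)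
      (fun d i => σ.toRepresentation (s (z i)) ⟨e (r d), he _⟩) (fun T d => ?_) (fun d => ?_)
      (fun d i => ?_)
    · obtain ⟨d, g, c, h⟩ := hr v
      exact ⟨d, g, c, Subtype.ext h⟩
    · refine mem_span_of_coe_mem_span ?_
      refine Submodule.span_le.2 ?_ (hspan (r d) _ (T ⟨e (r d), he (r d)⟩).2
        (transformsLike_intertwiner σ T ⟨e (r d), he (r d)⟩))
      rintro _ ⟨w, rfl⟩
      obtain ⟨i, c, hi⟩ := hz d w
      simp only [hi]
      exact Submodule.smul_mem _ _ (Submodule.subset_span ⟨i, rfl⟩)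
    · exact LinearIndependent.of_comp σ.toSubmodule.subtype (hu d)
    · obtain ⟨Q, c, hc, hQ, hQ', h1, h2⟩ := hex d i
      let T : σ.toRepresentation.IntertwiningMap σ.toRepresentation :=
        ⟨Q.restrict hQ, fun g => LinearMap.ext fun f => Subtype.ext (hQ' g f f.2)⟩
      refine ⟨c⁻¹ • T, Subtype.ext ?_, fun d' hd' => Subtype.ext ?_⟩
      · change c⁻¹ • Q (e (r d)) = _
        rw [h1, inv_smul_smul₀ hc]
        rfl
      · change c⁻¹ • Q (e (r d')) = 0
        rw [h2 d' hd', smul_zero]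
  refine numConstituents_and_length σ.toRepresentation (fun f g => ?_) ?_
  · obtain ⟨f, rfl⟩ :=
      (Representation.IntertwiningMap.equivAlgEnd (ρ := σ.toRepresentation)).surjective f
    obtain ⟨g, rfl⟩ :=
      (Representation.IntertwiningMap.equivAlgEnd (ρ := σ.toRepresentation)).surjective g
    rw [← map_mul, ← map_mul, hcomm]
  · rw [← hrank]
    exact (Representation.IntertwiningMap.equivAlgEnd
      (ρ := σ.toRepresentation)).toLinearEquiv.finrank_eq.symm

end Subrepresentation

/-! ### The endomorphism algebra of Top. -/

section TopEndomorphisms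

variable {R : Type*} [CommRing R] {x : R} {V : Type*} [AddCommGroup V]
  [Module (RamExt x) V] {h : V →ₗ⋆[RamExt x] V →ₗ[RamExt x] RamExt x} {lam : AddChar R ℂ}
  {l : ℕ}

theorem mem_span_of_weilCoeff [Finite V] {hl : x ^ l = 0} {f : WeilSpace h lam hl}
    (hf : f ∈ weilSpan h lam hl) {I : Type*} {v : I → V}
    (hv : ∀ w, weilCoeff h lam hl w f ≠ 0 → ∃ i, w - v i ∈ yPow x V l) :
    f ∈ Submodule.span ℂ (Set.range fun i => weilVec h lam hl (v i)) := by
  have := Fintype.ofFinite V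
  have hcard : (Nat.card (yPow x V l) : ℂ) ≠ 0 := Nat.cast_ne_zero.2 Nat.card_pos.ne'
  rw [← Submodule.smul_mem_iff _ hcard, ← sum_weilCoeff_smul hf]
  refine Submodule.sum_mem _ fun w _ => ?_
  by_cases hw : weilCoeff h lam hl w f = 0
  · rw [hw, zero_smul]; exact Submodule.zero_mem _
  · obtain ⟨i, hi⟩ := hv w hw
    rw [weilVec_of_sub_mem h lam hl hi]
    exact Submodule.smul_mem _ _ (Submodule.smul_mem _ _ (Submodule.subset_span ⟨i, rfl⟩))

theorem linearIndependent_weilVec {hl : x ^ l = 0} {I : Type*} {v : I → V}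
    (hv : ∀ i j, v i - v j ∈ yPow x V l → i = j) :
    LinearIndependent ℂ fun i => weilVec h lam hl (v i) := by
  classical
  rw [linearIndependent_iff']
  intro s a ha i hi
  have h1 := congrArg (weilCoeff h lam hl (v i)) ha
  rw [map_sum, map_zero, Finset.sum_eq_single_of_mem i hi, map_smul, weilCoeff_weilVec,
    if_pos (by simp), sub_self, map_zero, AddChar.map_zero_eq_one, smul_eq_mul, mul_one] at h1
  · exact h1
  · intro j _ hj
    rw [map_smul, weilCoeff_weilVec, if_neg (fun hij => hj (hv i j hij).symm), smul_zero]

/-- The scalars of norm one in `A`. -/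
abbrev NormOne (x : R) : Type _ := {z : RamExt x // z * star z = 1}

theorem scalarUnitary_comm (z z' : NormOne x) :
    scalarUnitary h z.1 z.2 * scalarUnitary h z'.1 z'.2 =
      scalarUnitary h z'.1 z'.2 * scalarUnitary h z.1 z.2 := by
  apply Subtype.ext
  apply LinearEquiv.ext
  intro v
  change z.1 • z'.1 • v = z'.1 • z.1 • v
  rw [smul_comm]

theorem exists_normOne_of_transformsLike [Finite R] [Module.Free (RamExt x) V]
    (hh : IsNondegHermitian h) (H : IsUniformizer x l) (hlam : lam.IsPrimitive) {v : V}
    (hv : v ∉ yPow x V 1) {f : WeilSpace h lam H.pow} (hf : f ∈ weilSpan h lam H.pow)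
    (hvf : TransformsLike (weilRep h lam H.pow) (weilVec h lam H.pow v) f) (w : V)
    (hw : weilCoeff h lam H.pow w f ≠ 0) : ∃ z : NormOne x, w - z.1 • v ∈ yPow x V l := by
  obtain ⟨z, hz, h2⟩ := hh.exists_scalar_of_weilCoeff_ne_zero H hlam hv hf hvf hw
  exact ⟨⟨z, hz⟩, h2⟩

/-- The set of values `h(v, v)` of primitive vectors. -/
def quadValues (h : V →ₗ⋆[RamExt x] V →ₗ[RamExt x] RamExt x) : Set R :=
  quad h '' {v | v ∉ yPow x V 1}

/-- The values `h(v, v)` of primitive vectors modulo the traces of elements of `yˡ A`. -/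
def quadClasses (h : V →ₗ⋆[RamExt x] V →ₗ[RamExt x] RamExt x) (l : ℕ) :
    Set (R ⧸ Ideal.span {x ^ (l - l / 2)}) :=
  Ideal.Quotient.mk _ '' quadValues h

/-- The scalars of norm one modulo `yˡ`. -/
def normOneClasses (x : R) (l : ℕ) : Set (RamExt x ⧸ Ideal.span {gen x ^ l}) :=
  Ideal.Quotient.mk _ '' {z | z * star z = 1}

/-- The class of `h(v, v)`. -/
def quadClass (h : V →ₗ⋆[RamExt x] V →ₗ[RamExt x] RamExt x) (l : ℕ) (v : V) :
    R ⧸ Ideal.span {x ^ (l - l / 2)} := Ideal.Quotient.mk _ (quad h v)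

theorem quadClass_eq_iff (v w : V) :
    quadClass h l v = quadClass h l w ↔ x ^ (l - l / 2) ∣ quad h v - quad h w := by
  rw [quadClass, quadClass, Ideal.Quotient.mk_eq_mk_iff_sub_mem, Ideal.mem_span_singleton]

open Classical in
/-- The projection, up to a scalar, to the span of the `e_w` with `h(w, w)` in a given class. -/
noncomputable def classProj [Fintype V] (h : V →ₗ⋆[RamExt x] V →ₗ[RamExt x] RamExt x)
    (lam : AddChar R ℂ) (hl : x ^ l = 0) (d : R ⧸ Ideal.span {x ^ (l - l / 2)}) :
    WeilSpace h lam hl →ₗ[ℂ] WeilSpace h lam hl :=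
  ∑ w with quadClass h l w = d, (weilCoeff h lam hl w).smulRight (weilVec h lam hl w)

-- The class of h(w, w) is constant on cosets of V₀ by `dvd_quad_sub`, so the filter keeps or
-- discards the whole support of e_v.
open Classical in
theorem classProj_weilVec [Fintype V] (hh : IsNondegHermitian h) {hl : x ^ l = 0}
    (d : R ⧸ Ideal.span {x ^ (l - l / 2)}) (v : V) :
    classProj h lam hl d (weilVec h lam hl v) =
      if quadClass h l v = d then (Nat.card (yPow x V l) : ℂ) • weilVec h lam hl v else 0 := by
  rw [classProj, LinearMap.sum_apply, Finset.sum_filter]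
  simp only [LinearMap.smulRight_apply]
  have hterm : ∀ w, (if quadClass h l w = d then
      weilCoeff h lam hl w (weilVec h lam hl v) • weilVec h lam hl w else 0) =
      if quadClass h l v = d then
        weilCoeff h lam hl w (weilVec h lam hl v) • weilVec h lam hl w else 0 := by
    intro w
    by_cases hwv : w - v ∈ yPow x V l
    · rw [(quadClass_eq_iff w v).2 (hh.dvd_quad_sub hl hwv)]
    · rw [weilCoeff_weilVec, if_neg hwv, zero_smul, ite_self, ite_self]
  rw [Finset.sum_congr rfl fun w _ => hterm w]
  split_ifs
  · exact sum_weilCoeff_smul (Submodule.subset_span ⟨v, rfl⟩)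
  · exact Finset.sum_const_zero

theorem classProj_mem_top [Fintype V] (hh : IsNondegHermitian h) {hl : x ^ l = 0}
    (d : R ⧸ Ideal.span {x ^ (l - l / 2)}) {f : WeilSpace h lam hl}
    (hf : f ∈ (top h lam hl).toSubmodule) :
    classProj h lam hl d f ∈ (top h lam hl).toSubmodule := by
  refine Submodule.span_le (p := (top h lam hl).toSubmodule.comap (classProj h lam hl d)).2 ?_ hf
  rintro _ ⟨v, hv, rfl⟩
  classical
  change classProj h lam hl d (weilVec h lam hl v) ∈ (top h lam hl).toSubmodule
  rw [classProj_weilVec hh]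
  split_ifs
  · exact Submodule.smul_mem _ _ (Submodule.subset_span ⟨v, hv, rfl⟩)
  · exact Submodule.zero_mem _

theorem classProj_comm [Fintype V] (hh : IsNondegHermitian h) {hl : x ^ l = 0}
    (d : R ⧸ Ideal.span {x ^ (l - l / 2)}) (g : unitaryGroup h) {f : WeilSpace h lam hl}
    (hf : f ∈ weilSpan h lam hl) :
    classProj h lam hl d (weilRep h lam hl g f) = weilRep h lam hl g (classProj h lam hl d f) := by
  refine eq_of_mem_weilSpan (F := classProj h lam hl d ∘ₗ weilRep h lam hl g)
    (G := weilRep h lam hl g ∘ₗ classProj h lam hl d) (fun v => ?_) hf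
  classical
  rw [LinearMap.comp_apply, LinearMap.comp_apply, weilRep_weilVec, classProj_weilVec hh,
    classProj_weilVec hh, quadClass, quad_unitary, ← quadClass]
  split_ifs
  · rw [map_smul, weilRep_weilVec]
  · rw [map_zero]

theorem finite_ramExt [Finite R] : Finite (RamExt x) :=
  Finite.of_equiv _ (QuadraticAlgebra.equivProd x 0).symm

theorem finite_unitaryGroup [Finite V] : Finite (unitaryGroup h) :=
  Finite.of_injective (fun g => ((g : V ≃ₗ[RamExt x] V) : V → V))
    fun _ _ hg => Subtype.ext (LinearEquiv.ext (congrFun hg))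

theorem weilRep_scalarUnitary (hl : x ^ l = 0) (z : NormOne x) (v : V) :
    weilRep h lam hl (scalarUnitary h z.1 z.2) (weilVec h lam hl v) =
      weilVec h lam hl (z.1 • v) :=
  weilRep_weilVec h lam hl _ v

theorem scalarUnitary_mul_comm (z : NormOne x) (g : unitaryGroup h) :
    scalarUnitary h z.1 z.2 * g = g * scalarUnitary h z.1 z.2 := by
  apply Subtype.ext
  apply LinearEquiv.ext
  intro v
  exact ((g : V ≃ₗ[RamExt x] V).map_smul z.1 v).symm

/-- The class projection followed by a scalar of norm one. -/
noncomputable def classMap [Fintype V] (h : V →ₗ⋆[RamExt x] V →ₗ[RamExt x] RamExt x)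
    (lam : AddChar R ℂ) (hl : x ^ l = 0) (d : R ⧸ Ideal.span {x ^ (l - l / 2)}) (z : NormOne x) :
    WeilSpace h lam hl →ₗ[ℂ] WeilSpace h lam hl :=
  weilRep h lam hl (scalarUnitary h z.1 z.2) ∘ₗ classProj h lam hl d

theorem classMap_mem_top [Fintype V] (hh : IsNondegHermitian h) {hl : x ^ l = 0}
    (d : R ⧸ Ideal.span {x ^ (l - l / 2)}) (z : NormOne x) {f : WeilSpace h lam hl}
    (hf : f ∈ (top h lam hl).toSubmodule) :
    classMap h lam hl d z f ∈ (top h lam hl).toSubmodule :=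
  (top h lam hl).apply_mem_toSubmodule _ (classProj_mem_top hh d hf)

theorem classMap_comm [Fintype V] (hh : IsNondegHermitian h) {hl : x ^ l = 0}
    (d : R ⧸ Ideal.span {x ^ (l - l / 2)}) (z : NormOne x) (g : unitaryGroup h)
    {f : WeilSpace h lam hl} (hf : f ∈ weilSpan h lam hl) :
    classMap h lam hl d z (weilRep h lam hl g f) =
      weilRep h lam hl g (classMap h lam hl d z f) := by
  rw [classMap, LinearMap.comp_apply, LinearMap.comp_apply, classProj_comm hh d g hf]
  exact representation_comm_apply _ (scalarUnitary_mul_comm z g) _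

open Classical in
theorem classMap_weilVec [Fintype V] (hh : IsNondegHermitian h) {hl : x ^ l = 0}
    (d : R ⧸ Ideal.span {x ^ (l - l / 2)}) (z : NormOne x) (v : V) :
    classMap h lam hl d z (weilVec h lam hl v) =
      if quadClass h l v = d then
        (Nat.card (yPow x V l) : ℂ) • weilRep h lam hl (scalarUnitary h z.1 z.2)
          (weilVec h lam hl v) else 0 := by
  rw [classMap, LinearMap.comp_apply, classProj_weilVec hh]
  split_ifs
  · rw [map_smul]
  · rw [map_zero]

/-- Each line of a vector `e_v` is in the orbit of the line of any vector of the same class. -/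
theorem exists_weilVec_eq_smul [Finite R] [Module.Free (RamExt x) V]
    (hh : IsNondegHermitian h) (H : IsUniformizer x l) {v w : V} (hv : v ∉ yPow x V 1)
    (hw : w ∉ yPow x V 1) (hvw : quadClass h l w = quadClass h l v) :
    ∃ (g : unitaryGroup h) (c : ℂ),
      weilVec h lam H.pow v = c • weilRep h lam H.pow g (weilVec h lam H.pow w) := by
  -- Move v inside v + V₀, which only rescales e_v, until its length equals that of w exactly; then
  -- the Witt theorem applies.
  obtain ⟨s, u, hs, hu⟩ := hh.exists_quad_eq H hv H.sub_div_two_pos ((quadClass_eq_iff _ _).1 hvw)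
  have hsu := smul_mem_yPow (IsUniformizer.gen_pow_dvd_algebraMap hs) u
  obtain ⟨g, hg⟩ := hh.exists_unitary_of_quad_eq H hw
    (IsNondegHermitian.notMem_of_sub_mem H hv (by rwa [add_sub_cancel_left])) hu.symm
  refine ⟨g, muChar x lam (h v (algebraMap R (RamExt x) s • u)), ?_⟩
  rw [weilRep_weilVec, hg, weilVec_add h lam H.pow _ hsu, smul_smul, muChar_mul_neg, one_smul]

/-- Length classes index the U-orbits of lines ℂe_v, norm-one classes index a basis of the possible
images of one e_v, and the maps `classMap` realize each image on one orbit and zero on the others.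
-/
theorem numConstituents_and_length_top [Finite R] [Finite V] [Module.Free (RamExt x) V]
    (hh : IsNondegHermitian h) (H : IsUniformizer x l) (hlam : lam.IsPrimitive) :
    numConstituents (top h lam H.pow).toRepresentation =
      Nat.card (quadClasses h l) * Nat.card (normOneClasses x l) ∧
    lengthOf (top h lam H.pow).toRepresentation =
      (Nat.card (quadClasses h l) * Nat.card (normOneClasses x l) : ℕ) := by
  have : Finite (RamExt x) := finite_ramExt
  have : Finite (unitaryGroup h) := finite_unitaryGroup
  have : Finite (R ⧸ Ideal.span {x ^ (l - l / 2)}) :=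
    Finite.of_surjective _ Ideal.Quotient.mk_surjective
  have : Finite (RamExt x ⧸ Ideal.span {gen x ^ l}) :=
    Finite.of_surjective _ Ideal.Quotient.mk_surjective
  have hD : ∀ d : quadClasses h l, ∃ v : {v : V // v ∉ yPow x V 1}, quadClass h l v.1 = d := by
    rintro ⟨_, ⟨_, ⟨v, hv, rfl⟩, rfl⟩⟩
    exact ⟨⟨v, hv⟩, rfl⟩
  have hI : ∀ ζ : normOneClasses x l, ∃ z : NormOne x,
      Ideal.Quotient.mk (Ideal.span {gen x ^ l}) z.1 = ζ := by
    rintro ⟨_, ⟨z, hz, rfl⟩⟩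
    exact ⟨⟨z, hz⟩, rfl⟩
  choose r hr using hD
  choose z hz using hI
  refine numConstituents_and_length_of_span (top h lam H.pow)
    (e := fun v : {v : V // v ∉ yPow x V 1} => weilVec h lam H.pow v.1) (Set.image_eq_range _ _ ▸ rfl)
    (s := fun z : NormOne x => scalarUnitary h z.1 z.2) scalarUnitary_comm ?_ r ?_ z ?_ ?_ ?_
  · intro v f hf hvf
    simp only [weilRep_scalarUnitary]
    exact mem_span_of_weilCoeff (top_le_weilSpan h lam H.pow hf)
      (exists_normOne_of_transformsLike hh H hlam v.2 (top_le_weilSpan h lam H.pow hf) hvf)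
  · intro v
    exact ⟨⟨quadClass h l v.1, ⟨_, ⟨v.1, v.2, rfl⟩, rfl⟩⟩,
      exists_weilVec_eq_smul hh H v.2 (r _).2 (hr _)⟩
  · intro d w
    refine ⟨⟨_, ⟨w.1, w.2, rfl⟩⟩, ?_⟩
    have h2 : gen x ^ l ∣ w.1 - (z ⟨_, ⟨w.1, w.2, rfl⟩⟩).1 := by
      rw [← Ideal.mem_span_singleton, ← Ideal.Quotient.mk_eq_mk_iff_sub_mem, hz]
    have h3 := smul_mem_yPow h2 (r d).1
    rw [sub_smul] at h3
    simp only [weilRep_scalarUnitary]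
    exact ⟨_, weilVec_of_sub_mem h lam H.pow h3⟩
  · intro d
    simp only [weilRep_scalarUnitary]
    refine linearIndependent_weilVec fun ζ ζ' hζ => ?_
    rw [← sub_smul] at hζ
    have h2 := hh.gen_pow_dvd_of_smul_mem H (r d).2 hζ
    rw [← Ideal.mem_span_singleton, ← Ideal.Quotient.mk_eq_mk_iff_sub_mem, hz, hz] at h2
    exact Subtype.ext h2
  · intro d ζ
    classical
    have := Fintype.ofFinite V
    refine ⟨classMap h lam H.pow d (z ζ), Nat.card (yPow x V l),
      Nat.cast_ne_zero.2 Nat.card_pos.ne', fun f hf => classMap_mem_top hh _ _ hf,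
      fun g f hf => classMap_comm hh _ _ g (top_le_weilSpan h lam H.pow hf), ?_, ?_⟩
    · rw [classMap_weilVec hh, if_pos (hr d)]
    · intro d' hd'
      rw [classMap_weilVec hh, if_neg]
      rw [hr]
      exact fun hdd => hd' (Subtype.ext hdd)

end TopEndomorphisms

/-! ### Counting length classes, norm-one classes and orbits. -/

section Counting

variable {R : Type*} [CommRing R] {x : R} {V : Type*} [AddCommGroup V]
  [Module (RamExt x) V] {h : V →ₗ⋆[RamExt x] V →ₗ[RamExt x] RamExt x} {l : ℕ}

/-- Multiplication by x^j on R has kernel x^i R and image x^j R. -/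
theorem IsUniformizer.card_quotient (H : IsUniformizer x l) {i j : ℕ} (hij : i + j = l) :
    Nat.card (R ⧸ Ideal.span {x ^ i}) = Nat.card (Ideal.span {x ^ j}) := by
  have hker : Ideal.span {x ^ i} = LinearMap.ker (LinearMap.mulLeft R (x ^ j)) := by
    ext r
    rw [Ideal.mem_span_singleton, LinearMap.mem_ker, LinearMap.mulLeft_apply,
      H.pow_mul_eq_zero_iff (by omega), ← hij, Nat.add_sub_cancel]
  have hrange : Ideal.span {x ^ j} = LinearMap.range (LinearMap.mulLeft R (x ^ j)) := by
    ext r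
    rw [Ideal.mem_span_singleton, LinearMap.mem_range]
    exact ⟨fun ⟨s, hs⟩ => ⟨s, hs.symm⟩, fun ⟨s, hs⟩ => ⟨s, hs.symm⟩⟩
  rw [hker, hrange]
  exact Nat.card_congr (LinearMap.quotKerEquivRange _).toEquiv

/-- Norm one for r + sy means r² = 1 + xs²: s is arbitrary, and r is one of two roots, congruent to
1 or -1 modulo x. Modulo y^l only this sign and s modulo x^⌊l/2⌋ survive. -/
theorem IsUniformizer.card_normOneClasses [Finite R] (H : IsUniformizer x l) :
    Nat.card (normOneClasses x l) = 2 * Nat.card (R ⧸ Ideal.span {x ^ (l / 2)}) := by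
  have hroot : ∀ s : R, ∃ r : R, x ∣ r - 1 ∧ r ^ 2 = 1 + x * s ^ 2 := by
    intro s
    obtain ⟨t, ht, h2⟩ := H.exists_sq_eq_one_add (r := x * s ^ 2) (dvd_mul_right _ _)
    exact ⟨1 + t, by rwa [add_sub_cancel_left], h2⟩
  choose ρ hρ hρ2 using hroot
  let sg : Bool → RamExt x := fun b => if b then 1 else -1
  let F : Bool × (R ⧸ Ideal.span {x ^ (l / 2)}) → RamExt x ⧸ Ideal.span {gen x ^ l} := fun p =>
    Ideal.Quotient.mk _ (sg p.1 * ⟨ρ p.2.out, p.2.out⟩)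
  have htwo : ¬ x ∣ 2 := H.isUnit_iff.1 H.two
  have hKx : x ∣ x ^ (l - l / 2) := dvd_pow_self x (by have := H.pos; omega)
  have hsub : ∀ {a b r s : R}, gen x ^ l ∣ (⟨a, r⟩ : RamExt x) - ⟨b, s⟩ ↔
      x ^ (l - l / 2) ∣ a - b ∧ x ^ (l / 2) ∣ r - s := by
    intro a b r s
    rw [IsUniformizer.gen_pow_dvd_iff]
    simp
  have hout : ∀ s : R, x ^ (l / 2) ∣ s - (Ideal.Quotient.mk (Ideal.span {x ^ (l / 2)}) s).out := by
    intro s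
    rw [← Ideal.mem_span_singleton, ← Ideal.Quotient.mk_eq_mk_iff_sub_mem]
    exact (Quotient.out_eq' (Ideal.Quotient.mk (Ideal.span {x ^ (l / 2)}) s)).symm
  have hinj : Function.Injective F := by
    have key : ∀ s t : R ⧸ Ideal.span {x ^ (l / 2)}, x ^ (l / 2) ∣ s.out - t.out → s = t := by
      intro s t hst
      rw [← Quotient.out_eq' s, ← Quotient.out_eq' t]
      rw [← Ideal.mem_span_singleton] at hst
      exact (Ideal.Quotient.mk_eq_mk_iff_sub_mem _ _).2 hst
    have hne : ∀ s t : R, ¬ gen x ^ l ∣ (⟨ρ s, s⟩ : RamExt x) + ⟨ρ t, t⟩ := by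
      intro s t hst
      rw [show (⟨ρ s, s⟩ : RamExt x) + ⟨ρ t, t⟩ = ⟨ρ s, s⟩ - ⟨-ρ t, -t⟩ by ext <;> simp, hsub] at hst
      have h1 := dvd_sub (dvd_sub (hKx.trans hst.1) (hρ s)) (hρ t)
      exact htwo (by rwa [show ρ s - -ρ t - (ρ s - 1) - (ρ t - 1) = 2 by ring] at h1)
    rintro ⟨b, s⟩ ⟨c, t⟩ hbc
    have h1 : gen x ^ l ∣ sg b * ⟨ρ s.out, s.out⟩ - sg c * ⟨ρ t.out, t.out⟩ := by
      rw [← Ideal.mem_span_singleton, ← Ideal.Quotient.mk_eq_mk_iff_sub_mem]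
      exact hbc
    cases b <;> cases c <;> simp only [sg, if_true, Bool.false_eq_true, if_false, one_mul,
      neg_mul] at h1
    · rw [← dvd_neg, neg_sub, neg_sub_neg, hsub] at h1
      rw [key s t h1.2]
    · rw [← dvd_neg, neg_sub, sub_neg_eq_add] at h1
      exact absurd h1 (hne _ _)
    · rw [sub_neg_eq_add] at h1
      exact absurd h1 (hne _ _)
    · rw [hsub] at h1
      rw [key s t h1.2]
  have hnorm : ∀ a s : R, (⟨a, s⟩ : RamExt x) * star (⟨a, s⟩ : RamExt x) = 1 ↔
      a ^ 2 = 1 + x * s ^ 2 := by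
    intro a s
    rw [← QuadraticAlgebra.algebraMap_norm_eq_mul_star, norm_eq,
      ← map_one (algebraMap R (RamExt x)), QuadraticAlgebra.algebraMap_inj]
    constructor <;> intro h1 <;> linear_combination h1
  have hclose : ∀ a s : R, x ∣ a - 1 → a ^ 2 = 1 + x * s ^ 2 →
      gen x ^ l ∣ (⟨ρ (Ideal.Quotient.mk (Ideal.span {x ^ (l / 2)}) s).out,
        (Ideal.Quotient.mk (Ideal.span {x ^ (l / 2)}) s).out⟩ : RamExt x) - ⟨a, s⟩ := by
    intro a s ha has
    have h1 := hout s
    set t := (Ideal.Quotient.mk (Ideal.span {x ^ (l / 2)}) s).out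
    rw [← dvd_neg, neg_sub, hsub]
    refine ⟨?_, h1⟩
    -- Since a + ρ(t) is a unit, a - ρ(t) is as divisible as x(s - t), and ⌈l/2⌉ ≤ ⌊l/2⌋ + 1: s
    -- modulo x^⌊l/2⌋ determines a modulo x^⌈l/2⌉.
    have hu : IsUnit (2 + ((a - 1) + (ρ t - 1))) := H.isUnit_add H.two (dvd_add ha (hρ t))
    have h2 : (2 + ((a - 1) + (ρ t - 1))) * (a - ρ t) = x * (s - t) * (s + t) := by
      linear_combination has - hρ2 t
    rw [← hu.dvd_mul_left, h2]
    refine Dvd.dvd.mul_right ?_ _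
    refine (pow_dvd_pow x (show l - l / 2 ≤ l / 2 + 1 by omega)).trans ?_
    rw [pow_succ']
    exact mul_dvd_mul_left x h1
  have hrange : Set.range F = normOneClasses x l := by
    apply Set.Subset.antisymm
    · rintro _ ⟨⟨b, s⟩, rfl⟩
      refine ⟨_, ?_, rfl⟩
      have h1 := (hnorm (ρ s.out) s.out).2 (hρ2 _)
      cases b <;> simpa [sg] using h1
    · rintro _ ⟨⟨a, s⟩, hz, rfl⟩
      have has := (hnorm a s).1 hz
      have hdvd : x ∣ (a - 1) * (a + 1) := ⟨s ^ 2, by linear_combination has⟩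
      rcases H.dvd_or_dvd hdvd with ha | ha
      · refine ⟨(true, Ideal.Quotient.mk _ s), ?_⟩
        rw [Ideal.Quotient.mk_eq_mk_iff_sub_mem, Ideal.mem_span_singleton]
        simpa [sg] using hclose a s ha has
      · refine ⟨(false, Ideal.Quotient.mk _ (-s)), ?_⟩
        rw [Ideal.Quotient.mk_eq_mk_iff_sub_mem, Ideal.mem_span_singleton, ← dvd_neg]
        have h1 := hclose (-a) (-s) (by rw [← dvd_neg]; simpa [add_comm] using ha)
          (by linear_combination has)
        convert h1 using 1
        simp only [sg, Bool.false_eq_true, if_false]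
        ext <;> simp <;> ring
  rw [← hrange, ← Nat.card_congr (Equiv.ofInjective F hinj), Nat.card_prod]
  simp

theorem notMem_yPow_add_algebraMap_smul {w : V} (hw : w ∉ yPow x V 1)
    {j : ℕ} (hj : 1 ≤ j) {r : R} (hr : x ^ j ∣ r) (u : V) :
    w + algebraMap R (RamExt x) r • u ∉ yPow x V 1 := by
  rwa [Submodule.add_mem_iff_left]
  refine smul_mem_yPow ?_ u
  rw [pow_one, IsUniformizer.gen_dvd_iff]
  exact (dvd_pow_self x (by omega)).trans hr

/-- By `exists_quad_eq` the set of primitive lengths is a union of cosets of x^⌈l/2⌉R. -/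
theorem card_quadValues [Finite R] [Module.Free (RamExt x) V] (hh : IsNondegHermitian h)
    (H : IsUniformizer x l) : Nat.card (quadValues h) =
      Nat.card (Ideal.span {x ^ (l - l / 2)}) * Nat.card (quadClasses h l) := by
  have hpre : quadValues h = (QuotientAddGroup.mk :
      R → R ⧸ (Ideal.span {x ^ (l - l / 2)}).toAddSubgroup) ⁻¹' quadClasses h l := by
    apply Set.Subset.antisymm
    · exact fun c hc => ⟨c, hc, rfl⟩
    · rintro c ⟨_, ⟨w, hw, rfl⟩, hc⟩
      have h1 : x ^ (l - l / 2) ∣ c - quad h w := by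
        rw [← Ideal.mem_span_singleton, ← Ideal.Quotient.mk_eq_mk_iff_sub_mem]
        exact hc.symm
      obtain ⟨r, u, hr, hu⟩ := hh.exists_quad_eq H hw H.sub_div_two_pos h1
      exact ⟨_, notMem_yPow_add_algebraMap_smul hw H.sub_div_two_pos hr u, hu⟩
  exact (Nat.card_congr ((Equiv.setCongr hpre).trans
    (QuotientAddGroup.preimageMkEquivAddSubgroupProdSet
      (Ideal.span {x ^ (l - l / 2)}).toAddSubgroup (quadClasses h l)))).trans (Nat.card_prod _ _)

theorem card_classes [Finite R] [Module.Free (RamExt x) V] (hh : IsNondegHermitian h)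
    (H : IsUniformizer x l) : Nat.card (quadClasses h l) * Nat.card (normOneClasses x l) =
      2 * Nat.card (quadValues h) := by
  rw [H.card_normOneClasses, H.card_quotient (show l / 2 + (l - l / 2) = l by omega),
    card_quadValues hh H]
  ring

/-- Each length c gives two orbits, that of a primitive v with h(v, v) = c and that of yv; the
Boolean tells them apart. -/
theorem orbitCount_eq [Finite R] [Module.Free (RamExt x) V] (hh : IsNondegHermitian h)
    (H : IsUniformizer x l) : orbitCount h = 2 * Nat.card (quadValues h) := by
  have hD : ∀ c : quadValues h, ∃ v : V, v ∉ yPow x V 1 ∧ quad h v = c := by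
    rintro ⟨_, ⟨v, hv, rfl⟩⟩
    exact ⟨v, hv, rfl⟩
  choose r hr hrc using hD
  have hquad : ∀ v w : V, v ∈ MulAction.orbit (unitaryGroup h) w → quad h v = quad h w := by
    rintro v w ⟨g, rfl⟩
    exact quad_unitary g w
  -- Here v - w lies in y^(2l-1)V. The exponent is odd, so the trace of y^(2l-1)b is y^(2l-1)(b -
  -- b*), and b - b* lies in yA; hence the cross terms vanish.
  have hgen : ∀ v w : V, gen x • v = gen x • w → quad h v = quad h w := by
    intro v w hvw
    have h1 : ∀ u, gen x ^ (2 * l - 1) ∣ h u (v - w) := by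
      intro u
      apply H.gen_pow_mul_eq_zero
      rw [pow_one, ← smul_eq_mul, ← map_smul, smul_sub, hvw, sub_self, map_zero]
    obtain ⟨e, he⟩ := hh.mem_yPow_iff.2 h1
    have he' : v = w + gen x ^ (2 * l - 1) • e := by
      rw [show gen x ^ (2 * l - 1) • e = v - w from he, add_sub_cancel]
    have h2 : gen x ^ (2 * l - 1) * h w e + star (gen x ^ (2 * l - 1) * h w e) = 0 := by
      have h3 : gen x ^ (2 * l - 1) * (h w e - star (h w e)) = 0 := by
        have h4 : gen x ∣ h w e - star (h w e) := by
          rw [IsUniformizer.gen_dvd_iff]; simp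
        obtain ⟨β, hβ⟩ := h4
        rw [hβ, ← mul_assoc, ← pow_succ, Nat.sub_add_cancel (by have := H.pos; omega),
          H.gen_pow_eq_zero, zero_mul]
      rw [star_mul', IsUniformizer.star_gen_pow, Odd.neg_one_pow ⟨l - 1, by have := H.pos; omega⟩]
      linear_combination h3
    have h5 : gen x ^ (2 * l - 1) * gen x ^ (2 * l - 1) = 0 := by
      rw [← pow_add, show 2 * l - 1 + (2 * l - 1) = 2 * l + (2 * l - 2) by have := H.pos; omega,
        pow_add, H.gen_pow_eq_zero, zero_mul]
    have h6 : h v v = h w w := by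
      rw [he']
      have h6 : h e w = star (h w e) := hh.symm w e
      simp only [map_add, LinearMap.add_apply, form_smul_left, map_smul, smul_eq_mul, h6,
        star_mul', IsUniformizer.star_gen_pow] at h2 ⊢
      linear_combination h2 + (-1) ^ (2 * l - 1) * h e e * h5
    rw [quad, quad, h6]
  let F : Bool × quadValues h → Set V := fun p =>
    MulAction.orbit (unitaryGroup h) (if p.1 then r p.2 else gen x • r p.2)
  have hgenmem : ∀ v : V, gen x • v ∈ yPow x V 1 := fun v => ⟨v, by simp⟩
  have horb : ∀ (g : unitaryGroup h) (v : V), g • v ∈ yPow x V 1 → v ∈ yPow x V 1 := by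
    rintro g v ⟨w, hw⟩
    refine ⟨g⁻¹ • w, ?_⟩
    have h1 : g⁻¹ • (gen x ^ 1 • w) = g⁻¹ • g • v := congrArg (g⁻¹ • ·) hw
    rw [inv_smul_smul] at h1
    rw [← h1]
    exact (((g⁻¹ : unitaryGroup h) : V ≃ₗ[RamExt x] V).map_smul (gen x ^ 1) w).symm
  have hinj : Function.Injective F := by
    rintro ⟨b, c⟩ ⟨b', c'⟩ hF
    have h1 : (if b then r c else gen x • r c) ∈
        MulAction.orbit (unitaryGroup h) (if b' then r c' else gen x • r c') := by
      change F (b, c) = F (b', c') at hF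
      have : (if b then r c else gen x • r c) ∈ F (b, c) := MulAction.mem_orbit_self _
      rwa [hF] at this
    cases b <;> cases b' <;> simp only [if_true, Bool.false_eq_true, if_false] at h1
    · obtain ⟨g, hg⟩ := h1
      have h2 : gen x • ((g : V ≃ₗ[RamExt x] V) (r c')) = gen x • r c := by
        rw [← map_smul]; exact hg
      have h3 := hgen _ _ h2
      rw [quad_unitary, hrc, hrc] at h3
      rw [Subtype.ext h3]
    · obtain ⟨g, hg⟩ := h1
      exact absurd (horb g (r c') (by rw [show g • r c' = _ from hg]; exact hgenmem _)) (hr c')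
    · obtain ⟨g, hg⟩ := h1
      refine absurd ?_ (hr c)
      rw [← show g • (gen x • r c') = r c from hg]
      rw [show g • (gen x • r c') = gen x • (g : V ≃ₗ[RamExt x] V) (r c') from
        (g : V ≃ₗ[RamExt x] V).map_smul _ _]
      exact hgenmem _
    · have h3 := hquad _ _ h1
      rw [hrc, hrc] at h3
      rw [Subtype.ext h3]
  have hrange : Set.range F =
      {O : Set V | ∃ v : V, v ∉ yPow x V 2 ∧ O = MulAction.orbit (unitaryGroup h) v} := by
    apply Set.Subset.antisymm
    · rintro _ ⟨⟨b, c⟩, rfl⟩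
      refine ⟨_, ?_, rfl⟩
      cases b
      · simp only [Bool.false_eq_true, if_false]
        rintro ⟨w, hw⟩
        have h1 : gen x • (gen x • w) = gen x • r c := by
          rw [smul_smul, ← sq]; exact hw
        have h2 := (hr c)
        rw [hh.notMem_yPow_one_iff H] at h2
        obtain ⟨u, hu⟩ := h2
        have h3 : gen x ^ 1 * (gen x * h u w - 1) = 0 := by
          have := congrArg (h u) h1
          simp only [map_smul, smul_eq_mul, hu] at this
          linear_combination this
        have h4 := H.gen_pow_mul_eq_zero h3
        have h5 : gen x ∣ gen x * h u w - 1 :=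
          (dvd_pow_self _ (by have := H.pos; omega)).trans h4
        rw [dvd_sub_right (dvd_mul_right _ _), H.gen_dvd_iff_not_isUnit] at h5
        exact h5 isUnit_one
      · simp only [if_true]
        exact fun hmem => hr c (yPow_le one_le_two hmem)
    · rintro _ ⟨v, hv, rfl⟩
      by_cases h1 : v ∈ yPow x V 1
      · obtain ⟨w, hw⟩ := h1
        have hw' : gen x • w = v := by rw [← hw]; simp
        have hwp : w ∉ yPow x V 1 := by
          rintro ⟨w', rfl⟩
          refine hv ⟨w', ?_⟩
          rw [← hw']
          simp [smul_smul, sq]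
        refine ⟨(false, ⟨quad h w, w, hwp, rfl⟩), ?_⟩
        obtain ⟨g, hg⟩ := hh.exists_unitary_of_quad_eq H (hr ⟨quad h w, w, hwp, rfl⟩) hwp (hrc _)
        refine (MulAction.orbit_eq_iff.2 ⟨g, ?_⟩).symm
        change (g : V ≃ₗ[RamExt x] V) (gen x • _) = v
        rw [map_smul, hg, hw']
      · refine ⟨(true, ⟨quad h v, v, h1, rfl⟩), ?_⟩
        obtain ⟨g, hg⟩ := hh.exists_unitary_of_quad_eq H (hr ⟨quad h v, v, h1, rfl⟩) h1 (hrc _)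
        exact (MulAction.orbit_eq_iff.2 ⟨g, hg⟩).symm
  rw [orbitCount, ← hrange, ← Nat.card_coe_set_eq,
    ← Nat.card_congr (Equiv.ofInjective F hinj), Nat.card_prod]
  simp

end Counting

/-! ### Orders, squares and binary forms in R. -/

namespace IsUniformizer

variable {R : Type*} [CommRing R] {x : R} {l : ℕ}

/-- Multiplication by x^j carries xR ⊆ R to x^(j+1)R ⊆ x^j R and has kernel inside xR as long as j <
l, so each step multiplies the index by [R : xR]. -/
theorem card_quotient_pow [Finite R] (H : IsUniformizer x l) {j : ℕ} (hj : j ≤ l) :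
    Nat.card (R ⧸ Ideal.span {x ^ j}) = Nat.card (R ⧸ Ideal.span {x}) ^ j := by
  induction j with
  | zero =>
    rw [pow_zero, pow_zero, Ideal.span_singleton_one]
    exact Nat.card_unique
  | succ j ih =>
    let f : R →+ R := AddMonoidHom.mulLeft (x ^ j)
    have hmap : (Ideal.span {x}).toAddSubgroup.map f = (Ideal.span {x ^ (j + 1)}).toAddSubgroup := by
      ext r
      simp only [AddSubgroup.mem_map, Submodule.mem_toAddSubgroup, Ideal.mem_span_singleton]
      constructor
      · rintro ⟨_, ⟨s, rfl⟩, rfl⟩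
        exact ⟨s, by simp only [f, AddMonoidHom.coe_mulLeft]; ring⟩
      · rintro ⟨s, rfl⟩
        exact ⟨x * s, dvd_mul_right _ _, by simp only [f, AddMonoidHom.coe_mulLeft]; ring⟩
    have hrange : f.range = (Ideal.span {x ^ j}).toAddSubgroup := by
      ext r
      simp only [AddMonoidHom.mem_range, Submodule.mem_toAddSubgroup, Ideal.mem_span_singleton]
      exact ⟨fun ⟨s, hs⟩ => ⟨s, hs.symm⟩, fun ⟨s, hs⟩ => ⟨s, hs.symm⟩⟩
    have hker : f.ker ≤ (Ideal.span {x}).toAddSubgroup := by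
      intro r hr
      have hr' : x ^ j * r = 0 := hr
      rw [H.pow_mul_eq_zero_iff (by omega)] at hr'
      exact Ideal.mem_span_singleton.2 ((dvd_pow_self x (by omega)).trans hr')
    have h1 := AddSubgroup.index_map (Ideal.span {x}).toAddSubgroup f
    rw [hmap, hrange, sup_eq_left.2 hker] at h1
    have h2 : Nat.card (R ⧸ Ideal.span {x ^ (j + 1)}) =
      Nat.card (R ⧸ Ideal.span {x}) * Nat.card (R ⧸ Ideal.span {x ^ j}) := h1
    rw [h2, ih (by omega), pow_succ']

theorem card_eq_pow [Finite R] (H : IsUniformizer x l) :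
    Nat.card R = Nat.card (R ⧸ Ideal.span {x}) ^ l := by
  rw [← H.card_quotient_pow le_rfl, H.card_quotient (add_zero l), pow_zero,
    Ideal.span_singleton_one]
  exact (Nat.card_congr (Equiv.Set.univ R)).symm

theorem card_isUnit [Finite R] (H : IsUniformizer x l) :
    Nat.card {r : R | IsUnit r} =
      Nat.card (R ⧸ Ideal.span {x}) ^ l - Nat.card (R ⧸ Ideal.span {x}) ^ (l - 1) := by
  have h1 : {r : R | IsUnit r}ᶜ = (Ideal.span {x} : Set R) := by
    ext r
    rw [Set.mem_compl_iff, Set.mem_ofPred_eq, H.not_isUnit_iff, SetLike.mem_coe,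
      Ideal.mem_span_singleton]
  have h2 := Set.ncard_add_ncard_compl {r : R | IsUnit r}
  have h3 := H.card_quotient (show (l - 1) + 1 = l from Nat.sub_add_cancel H.pos)
  rw [H.card_quotient_pow (Nat.sub_le _ _), pow_one] at h3
  rw [h1, H.card_eq_pow] at h2
  rw [h3, ← h2, Nat.card_coe_set_eq]
  exact (Nat.add_sub_cancel _ _).symm

/-- Squaring is two-to-one on units: if r² = s², the factors r - s and r + s differ by a unit, so
one of them is a unit and the other is 0. -/
theorem two_mul_card_isSquare_mul [Finite R] (H : IsUniformizer x l) {c : R} (hc : IsUnit c) :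
    2 * Nat.card {d : R | ∃ r, IsUnit r ∧ d = r ^ 2 * c} = Nat.card {r : R | IsUnit r} := by
  have hroot : ∀ d : {d : R | ∃ r, IsUnit r ∧ d = r ^ 2 * c}, ∃ r, IsUnit r ∧ d = r ^ 2 * c :=
    fun d => d.2
  choose ρ hρ hρ2 using hroot
  let F : Bool × {d : R | ∃ r, IsUnit r ∧ d = r ^ 2 * c} → {r : R | IsUnit r} := fun p =>
    ⟨if p.1 then ρ p.2 else -ρ p.2, by
      cases p.1
      · simpa using hρ p.2
      · simpa using hρ p.2⟩
  have hF : Function.Bijective F := by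
    constructor
    · rintro ⟨b, d⟩ ⟨b', d'⟩ hbd
      have h1 : (if b then ρ d else -ρ d) = if b' then ρ d' else -ρ d' := congrArg Subtype.val hbd
      have h2 : d = d' := by
        have h3 : ρ d ^ 2 = ρ d' ^ 2 := by
          have h4 := congrArg (· ^ 2) h1
          cases b <;> cases b' <;> simpa using h4
        exact Subtype.ext (by rw [hρ2 d, hρ2 d', h3])
      subst h2
      have hne : ρ d ≠ -ρ d := by
        intro h3
        have h4 : 2 * ρ d = 0 := by linear_combination h3
        have := (H.two.mul (hρ d))
        rw [h4, H.isUnit_iff] at this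
        exact this (dvd_zero x)
      cases b <;> cases b' <;> simp only [if_true, Bool.false_eq_true, if_false] at h1
      · rfl
      · exact absurd h1.symm hne
      · exact absurd h1 hne
      · rfl
    · rintro ⟨r, hr⟩
      let d : {d : R | ∃ r, IsUnit r ∧ d = r ^ 2 * c} := ⟨r ^ 2 * c, r, hr, rfl⟩
      have h1 : (ρ d - r) * (ρ d + r) = 0 := by
        have h2 : r ^ 2 * c = ρ d ^ 2 * c := hρ2 d
        rw [hc.mul_left_inj] at h2
        linear_combination -h2
      have h2 : IsUnit (2 * r) := H.two.mul hr
      rcases H.dvd_or_dvd (h1 ▸ dvd_zero x) with h3 | h3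
      · have h4 : IsUnit (ρ d + r) := by
          have := H.isUnit_add h2 h3
          rwa [show 2 * r + (ρ d - r) = ρ d + r by ring] at this
        refine ⟨(true, d), Subtype.ext ?_⟩
        rw [h4.mul_left_eq_zero, sub_eq_zero] at h1
        simpa [F] using h1
      · have h4 : IsUnit (ρ d - r) := by
          have := H.isUnit_add h2 ((dvd_neg).2 h3)
          rw [show 2 * r + -(ρ d + r) = -(ρ d - r) by ring] at this
          exact (IsUnit.neg_iff _).1 this
        refine ⟨(false, d), Subtype.ext ?_⟩
        rw [h4.mul_right_eq_zero] at h1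
        have : F (false, d) = -ρ d := by simp [F]
        rw [this]
        linear_combination -h1
  rw [← Nat.card_congr (Equiv.ofBijective F hF), Nat.card_prod]
  simp

theorem isSquare_mul_of_not_isSquare [Finite R] (H : IsUniformizer x l) {a b : Rˣ}
    (ha : ¬ IsSquare a) (hb : ¬ IsSquare b) : IsSquare (a * b) := by
  have key : 2 * Nat.card (powMonoidHom 2 : Rˣ →* Rˣ).range = Nat.card Rˣ := by
    have h1 := H.two_mul_card_isSquare_mul isUnit_one
    have h2 : Nat.card {r : R | IsUnit r} = Nat.card Rˣ :=
      (Nat.card_congr (Equiv.ofBijective (fun u : Rˣ => (⟨u, u.isUnit⟩ : {r : R | IsUnit r}))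
        ⟨fun u v huv => Units.ext (congrArg Subtype.val huv),
          fun ⟨_, u, hu⟩ => ⟨u, Subtype.ext hu⟩⟩)).symm
    rw [← h2, ← h1]
    congr 1
    refine Nat.card_congr (Equiv.ofBijective
      (fun u => ⟨(u : Rˣ), by
        obtain ⟨_, v, rfl⟩ := u
        exact ⟨v, v.isUnit, by simp⟩⟩) ⟨?_, ?_⟩)
    · intro u v huv
      exact Subtype.ext (Units.ext (congrArg Subtype.val huv))
    · rintro ⟨_, r, ⟨r, rfl⟩, rfl⟩
      exact ⟨⟨r ^ 2, r, rfl⟩, Subtype.ext (by simp)⟩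
  have hindex : (powMonoidHom 2 : Rˣ →* Rˣ).range.index = 2 := by
    have h1 := Subgroup.card_mul_index (powMonoidHom 2 : Rˣ →* Rˣ).range
    rw [← key, mul_comm] at h1
    exact Nat.eq_of_mul_eq_mul_right Nat.card_pos h1
  have hmem : ∀ u : Rˣ, u ∈ (powMonoidHom 2 : Rˣ →* Rˣ).range ↔ IsSquare u := by
    intro u
    rw [isSquare_iff_exists_sq]
    exact ⟨fun ⟨v, hv⟩ => ⟨v, hv.symm⟩, fun ⟨v, hv⟩ => ⟨v, hv.symm⟩⟩
  rw [← hmem, Subgroup.mul_mem_iff_of_index_two hindex, hmem, hmem]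
  exact iff_of_false ha hb

/-- The usual pigeonhole in the residue field, which has odd order because 2 is a unit. -/
theorem exists_binary_quadratic [Finite R] (H : IsUniformizer x l) {a b : R} (ha : IsUnit a)
    (hb : IsUnit b) (c : R) : ∃ s t : R, x ∣ c - (a * s ^ 2 + b * t ^ 2) := by
  have hmax : (Ideal.span {x}).IsMaximal := by
    refine ⟨⟨?_, ?_⟩⟩
    · rw [Ne, Ideal.span_singleton_eq_top]
      exact H.not_unit
    · intro J hJ
      obtain ⟨r, hr, hrx⟩ := SetLike.exists_of_lt hJ
      rw [Ideal.mem_span_singleton, ← H.isUnit_iff] at hrx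
      exact Ideal.eq_top_of_isUnit_mem J hr hrx
  have : Finite (R ⧸ Ideal.span {x}) := Finite.of_surjective _ Ideal.Quotient.mk_surjective
  let : Field (R ⧸ Ideal.span {x}) := Ideal.Quotient.field _
  let : Fintype (R ⧸ Ideal.span {x}) := Fintype.ofFinite _
  let π := Ideal.Quotient.mk (Ideal.span {x})
  have hunit : ∀ {r : R}, IsUnit r → π r ≠ 0 := fun hr => (hr.map π).ne_zero
  have hchar : ringChar (R ⧸ Ideal.span {x}) ≠ 2 := by
    intro h2
    have h3 := (ringChar.spec (R ⧸ Ideal.span {x}) 2).2 (by rw [h2])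
    exact hunit H.two (by rw [map_ofNat]; exact_mod_cast h3)
  obtain ⟨s, t, hst⟩ := FiniteField.exists_root_sum_quadratic
    (f := Polynomial.C (π a) * Polynomial.X ^ 2 + Polynomial.C 0 * Polynomial.X +
      Polynomial.C (-π c))
    (g := Polynomial.C (π b) * Polynomial.X ^ 2 + Polynomial.C 0 * Polynomial.X +
      Polynomial.C 0)
    (Polynomial.degree_quadratic (hunit ha)) (Polynomial.degree_quadratic (hunit hb))
    (FiniteField.odd_card_of_char_ne_two hchar)
  obtain ⟨s, rfl⟩ := Ideal.Quotient.mk_surjective s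
  obtain ⟨t, rfl⟩ := Ideal.Quotient.mk_surjective t
  refine ⟨s, t, ?_⟩
  rw [← Ideal.mem_span_singleton, ← Ideal.Quotient.eq_zero_iff_mem]
  simp only [Polynomial.eval_add, Polynomial.eval_mul, Polynomial.eval_C, Polynomial.eval_pow,
    Polynomial.eval_X, zero_mul, add_zero] at hst
  simp only [map_sub, map_add, map_mul, map_pow]
  linear_combination -hst

end IsUniformizer

/-! ### Lengths of primitive vectors according to the rank and type of h. -/

namespace IsNondegHermitian

variable {R : Type*} [CommRing R] {x : R} {V : Type*} [AddCommGroup V]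
  [Module (RamExt x) V] {h : V →ₗ⋆[RamExt x] V →ₗ[RamExt x] RamExt x} {l : ℕ}

theorem notMem_yPow_one_of_isUnit_quad (H : IsUniformizer x l) {v : V} (hv : IsUnit (quad h v)) :
    v ∉ yPow x V 1 :=
  notMem_yPow_one_of_isUnit H (H.isUnit_ext_iff.2 hv)

theorem quad_smul_add_smul (hh : IsNondegHermitian h) (H : IsUniformizer x l) {u v : V}
    (huv : h u v = 0) (α β : RamExt x) :
    quad h (α • u + β • v) = α.norm * quad h u + β.norm * quad h v := by
  have hvu : h v u = 0 := by rw [hh.symm u v, huv, star_zero]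
  have h1 : h (α • u + β • v) (α • u + β • v) =
      algebraMap R (RamExt x) (α.norm * quad h u + β.norm * quad h v) := by
    simp only [map_add, LinearMap.add_apply, form_smul_left, map_smul, smul_eq_mul, huv, hvu,
      hh.form_self H, map_mul, QuadraticAlgebra.algebraMap_norm_eq_mul_star]
    ring
  rw [quad, h1, QuadraticAlgebra.algebraMap_re]

/-- Reduces the determination of all lengths to the residue field: a primitive w can be moved within
w + xV to attain any length congruent to its own. -/
theorem mem_quadValues_of_dvd_sub [Finite R] [Module.Free (RamExt x) V]
    (hh : IsNondegHermitian h) (H : IsUniformizer x l) {w : V} (hw : w ∉ yPow x V 1) {c : R}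
    (hc : x ∣ c - quad h w) : c ∈ quadValues h := by
  obtain ⟨r, u, hr, hu⟩ := hh.exists_quad_eq H hw le_rfl (by rwa [pow_one])
  exact ⟨_, notMem_yPow_add_algebraMap_smul hw le_rfl hr u, hu⟩

theorem exists_dvd_sub_quad [Finite R] (hh : IsNondegHermitian h) (H : IsUniformizer x l)
    {u v : V} (hu : IsUnit (quad h u)) (hv : IsUnit (quad h v)) (huv : h u v = 0) (c : R) :
    ∃ s t : R, x ∣ c - quad h (algebraMap R (RamExt x) s • u + algebraMap R (RamExt x) t • v) := by
  obtain ⟨s, t, hst⟩ := H.exists_binary_quadratic hu hv c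
  refine ⟨s, t, ?_⟩
  rw [hh.quad_smul_add_smul H huv, norm_eq, norm_eq]
  simpa [mul_comm] using hst

theorem isUnit_mem_quadValues [Finite R] [Module.Free (RamExt x) V] (hh : IsNondegHermitian h)
    (H : IsUniformizer x l) {u v : V} (hu : IsUnit (quad h u)) (hv : IsUnit (quad h v))
    (huv : h u v = 0) {c : R} (hc : IsUnit c) : c ∈ quadValues h := by
  obtain ⟨s, t, hst⟩ := hh.exists_dvd_sub_quad H hu hv huv c
  refine hh.mem_quadValues_of_dvd_sub H (notMem_yPow_one_of_isUnit_quad (h := h) H ?_) hst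
  rw [H.isUnit_iff] at hc ⊢
  exact fun hd => hc (by simpa using dvd_add hst hd)

theorem quadValues_eq_univ [Finite R] [Module.Free (RamExt x) V] (hh : IsNondegHermitian h)
    (H : IsUniformizer x l) {u v : V} (hu : IsUnit (quad h u)) (hv : IsUnit (quad h v))
    (huv : h u v = 0) {w : V} (hw : w ∉ yPow x V 1) (hwx : x ∣ quad h w) :
    quadValues h = Set.univ := by
  refine Set.eq_univ_of_forall fun c => ?_
  rcases H.unit_or c with hc | hc
  · exact hh.isUnit_mem_quadValues H hu hv huv hc
  · exact hh.mem_quadValues_of_dvd_sub H hw (dvd_sub hc hwx)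

/-- An orthogonal family of fewer than `rank V` vectors of unit length can be enlarged. -/
theorem exists_orthogonal [Module.Free (RamExt x) V] [Module.Finite (RamExt x) V]
    (hh : IsNondegHermitian h) (H : IsUniformizer x l) {k : ℕ} (s : Fin k → V)
    (hs : ∀ i j, i ≠ j → h (s i) (s j) = 0) (hu : ∀ i, IsUnit (quad h (s i)))
    (hk : k < Module.finrank (RamExt x) V) :
    ∃ v, (∀ i, h (s i) v = 0) ∧ IsUnit (quad h v) := by
  have hnt : Nontrivial (RamExt x) := ⟨_, _, H.gen_pow_pred_ne_zero⟩
  by_contra! hcon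
  have hinv : ∀ i, ∃ β, h (s i) (s i) * β = 1 :=
    fun i => (H.isUnit_ext_iff.2 (hu i)).exists_right_inv
  choose β hβ using hinv
  -- P is the orthogonal projection away from the family. If no vector of the complement has unit
  -- length, polarization puts all pairings there in yA, so the complement lies in yV.
  let P : V → V := fun w => w - ∑ i, (β i * h (s i) w) • s i
  have hP : ∀ w i, h (s i) (P w) = 0 := by
    intro w i
    simp only [P, map_sub, map_sum, map_smul, smul_eq_mul]
    rw [Finset.sum_eq_single i (fun j _ hj => by rw [hs i j hj.symm, mul_zero]) (by simp)]
    linear_combination -(h (s i) w) * hβ i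
  have hnon : ∀ w, (∀ i, h (s i) w = 0) → x ∣ (h w w).re := fun w hw =>
    H.not_isUnit_iff.1 (hcon w hw)
  have hpair : ∀ u w, (∀ i, h (s i) u = 0) → (∀ i, h (s i) w = 0) → gen x ∣ h u w := by
    intro u w hu' hw'
    have h1 := hnon (u + w) fun i => by rw [map_add, hu', hw', add_zero]
    simp only [map_add, LinearMap.add_apply, QuadraticAlgebra.re_add, hh.symm u w,
      QuadraticAlgebra.re_star] at h1
    rw [IsUniformizer.gen_dvd_iff]
    have h2 := dvd_sub (dvd_sub h1 (hnon u hu')) (hnon w hw')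
    refine H.two.dvd_mul_left.1 ?_
    convert h2 using 1
    simp
    ring
  have hperp : ∀ u, (∀ i, h (s i) u = 0) → u ∈ yPow x V 1 := by
    intro u hu'
    rw [hh.mem_yPow_iff]
    intro w
    have h1 : h w u = star (h u (P w)) := by
      have h2 : ∀ i, h u (s i) = 0 := fun i => by rw [hh.symm (s i) u, hu', star_zero]
      rw [← hh.symm u (P w), ]
      simp only [P, map_sub, map_sum, LinearMap.sub_apply, LinearMap.sum_apply, form_smul_left, hu',
        mul_zero, Finset.sum_const_zero, sub_zero]
    rw [h1]
    exact IsUniformizer.gen_pow_dvd_star (by rw [pow_one]; exact hpair u _ hu' (hP w))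
  -- Nakayama by iteration: V is the span plus y^n V for every n, and y^(2l) = 0, so fewer vectors
  -- than the rank would span V.
  have hgen : ∀ n (v : V), ∃ w, v - gen x ^ n • w ∈ Submodule.span (RamExt x) (Set.range s) := by
    intro n
    induction n with
    | zero => exact fun v => ⟨v, by simp⟩
    | succ n ih =>
      intro v
      obtain ⟨w, hw⟩ := ih v
      obtain ⟨w', hw'⟩ := hperp (P w) (hP w)
      refine ⟨w', ?_⟩
      have h1 : gen x ^ 1 • w' = P w := hw'
      have h2 : v - gen x ^ (n + 1) • w' =
          (v - gen x ^ n • w) + gen x ^ n • ∑ i, (β i * h (s i) w) • s i := by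
        rw [pow_succ, mul_smul, ← pow_one (gen x), ← pow_mul, one_mul, h1]
        simp only [P, smul_sub]
        abel
      rw [h2]
      refine add_mem hw (Submodule.smul_mem _ _ (Submodule.sum_mem _ fun i _ => ?_))
      exact Submodule.smul_mem _ _ (Submodule.subset_span ⟨i, rfl⟩)
  have hspan : Submodule.span (RamExt x) (Set.range s) = ⊤ := by
    rw [eq_top_iff]
    intro v _
    obtain ⟨w, hw⟩ := hgen (2 * l) v
    rwa [H.gen_pow_eq_zero, zero_smul, sub_zero] at hw
  have h1 := finrank_range_le_card (R := RamExt x) s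
  rw [Set.finrank, hspan, finrank_top, Fintype.card_fin] at h1
  omega

/-- In rank two, orthogonal vectors of unit length form a basis. -/
theorem hasType_of_orthogonal [Finite R] [Module.Free (RamExt x) V] [Module.Finite (RamExt x) V]
    (hh : IsNondegHermitian h) (H : IsUniformizer x l) (hrank : Module.finrank (RamExt x) V = 2)
    {u v : V} (huv : h u v = 0) {a b : Rˣ} (hu : quad h u = a) (hv : quad h v = b) :
    HasType h ![a, b] := by
  have hnt : Nontrivial (RamExt x) := ⟨_, _, H.gen_pow_pred_ne_zero⟩
  have := finite_ramExt (x := x)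
  have hvu : h v u = 0 := by rw [hh.symm u v, huv, star_zero]
  have huu : IsUnit (h u u) := H.isUnit_ext_iff.2 (hu ▸ a.isUnit : IsUnit (quad h u))
  have hvv : IsUnit (h v v) := H.isUnit_ext_iff.2 (hv ▸ b.isUnit : IsUnit (quad h v))
  have hli : LinearIndependent (RamExt x) ![u, v] := by
    rw [LinearIndependent.pair_iff]
    intro α β hαβ
    have h1 := congrArg (h u) hαβ
    have h2 := congrArg (h v) hαβ
    simp only [map_add, map_smul, smul_eq_mul, huv, hvu, mul_zero, add_zero, zero_add, map_zero]
      at h1 h2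
    exact ⟨huu.mul_left_eq_zero.1 h1, hvv.mul_left_eq_zero.1 h2⟩
  let e : V ≃ₗ[RamExt x] (Fin 2 → RamExt x) := (Module.finBasisOfFinrankEq _ _ hrank).equivFun
  -- Spanning comes from finiteness: an injective map between the finite sets A² and V ≅ A² is onto.
  have hinj : Function.Injective (Fintype.linearCombination (RamExt x) ![u, v]) :=
    hli.fintypeLinearCombination_injective
  have hsurj : Function.Surjective (Fintype.linearCombination (RamExt x) ![u, v]) := by
    have h1 := Finite.surjective_of_injective (e.injective.comp hinj)
    exact (Function.Surjective.of_comp_iff' e.bijective _).1 h1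
  have hsp : ⊤ ≤ Submodule.span (RamExt x) (Set.range ![u, v]) := by
    rw [← Fintype.range_linearCombination, LinearMap.range_eq_top.2 hsurj]
  refine ⟨Module.Basis.mk hli hsp, ?_⟩
  intro i j
  rw [Module.Basis.mk_apply, Module.Basis.mk_apply]
  fin_cases i <;> fin_cases j <;> simp [huv, hvu, hh.form_self H, hu, hv]

/-- The lengths are N(α)h(b, b) with α a unit of A and b a basis vector. Since N(α) is congruent to
a square modulo x, norms of units are exactly the squares of units of R. -/
theorem card_quadValues_of_finrank_eq_one [Finite R] [Module.Free (RamExt x) V]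
    [Module.Finite (RamExt x) V] (hh : IsNondegHermitian h) (H : IsUniformizer x l)
    (hrank : Module.finrank (RamExt x) V = 1) :
    2 * Nat.card (quadValues h) = Nat.card {r : R | IsUnit r} := by
  obtain ⟨u, -, hu⟩ := hh.exists_orthogonal H (k := 0) Fin.elim0 (fun i => i.elim0)
    (fun i => i.elim0) (by omega)
  have hnt : Nontrivial (RamExt x) := ⟨_, _, H.gen_pow_pred_ne_zero⟩
  let b := Module.finBasisOfFinrankEq (RamExt x) V hrank
  have hb : ∀ v, ∃ α : RamExt x, v = α • b 0 := by
    intro v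
    refine ⟨b.repr v 0, ?_⟩
    conv_lhs => rw [← b.sum_repr v]
    simp
  have hq : ∀ α : RamExt x, quad h (α • b 0) = α.norm * quad h (b 0) := by
    intro α
    have := hh.quad_smul_add_smul H (map_zero (h (b 0))) α 0
    simpa using this
  have hc : IsUnit (quad h (b 0)) := by
    obtain ⟨α, rfl⟩ := hb u
    rw [hq] at hu
    exact isUnit_of_mul_isUnit_right hu
  rw [← H.two_mul_card_isSquare_mul hc]
  congr 3
  ext d
  constructor
  · rintro ⟨v, hv, rfl⟩
    obtain ⟨α, rfl⟩ := hb v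
    have hα : IsUnit α := by
      by_contra hα
      rw [← H.gen_dvd_iff_not_isUnit] at hα
      exact hv (smul_mem_yPow (by rwa [pow_one]) _)
    obtain ⟨r, hr, -⟩ := H.isSquare_of_dvd_sub (u := α.norm) (a := α.re)
      (QuadraticAlgebra.isUnit_iff_norm_isUnit.1 hα) ⟨-α.im ^ 2, by rw [norm_eq]; ring⟩
    refine ⟨r, ?_, by rw [hq, hr]⟩
    have := QuadraticAlgebra.isUnit_iff_norm_isUnit.1 hα
    rw [← hr] at this
    exact (isUnit_pow_iff two_ne_zero).1 this
  · rintro ⟨r, hr, rfl⟩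
    have h1 : quad h (algebraMap R (RamExt x) r • b 0) = r ^ 2 * quad h (b 0) := by
      rw [hq, norm_eq]; simp
    exact ⟨_, notMem_yPow_one_of_isUnit_quad H (by rw [h1]; exact (hr.pow 2).mul hc), h1⟩

/-- Modulo x the length is α² - εβ², anisotropic because ε remains a non-square in the residue
field; so a vector of non-unit length lies in yV. -/
theorem quadValues_of_hasType_neg_nonsquare [Finite R] [Module.Free (RamExt x) V]
    (hh : IsNondegHermitian h) (H : IsUniformizer x l) {ε : Rˣ} (hε : ¬ IsSquare ε)
    (ht : HasType h ![1, -ε]) : quadValues h = {r : R | IsUnit r} := by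
  obtain ⟨b, hb⟩ := ht
  have h01 : h (b 0) (b 1) = 0 := by simpa using hb 0 1
  have h0 : quad h (b 0) = 1 := by rw [quad, hb 0 0]; simp [QuadraticAlgebra.re_one]
  have h1 : quad h (b 1) = -ε := by rw [quad, hb 1 1]; simp
  apply Set.Subset.antisymm
  · rintro _ ⟨v, hv, rfl⟩
    rw [Set.mem_ofPred_eq, H.isUnit_iff]
    intro hd
    rw [← b.sum_repr v, Fin.sum_univ_two] at hd hv
    set α := b.repr v 0
    set β := b.repr v 1
    rw [hh.quad_smul_add_smul H h01, h0, h1, norm_eq, norm_eq] at hd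
    have h2 : x ∣ α.re ^ 2 - ε * β.re ^ 2 := by
      have := dvd_add hd (dvd_mul_right x (α.im ^ 2 - ε * β.im ^ 2))
      convert this using 1
      ring
    rcases H.unit_or β.re with hβ | hβ
    · obtain ⟨γ, hγ⟩ := hβ.exists_right_inv
      obtain ⟨e, he, -⟩ := H.isSquare_of_dvd_sub (u := (ε : R)) (a := α.re * γ) ε.isUnit (by
        have := (h2.mul_right (γ ^ 2)).neg_right
        convert this using 1
        linear_combination (-ε) * (β.re * γ + 1) * hγ)
      have heu : IsUnit e := (isUnit_pow_iff two_ne_zero).1 (he ▸ ε.isUnit)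
      obtain ⟨e, rfl⟩ := heu
      exact hε ⟨e, Units.ext (by rw [← he]; simp [sq])⟩
    · have h3 : x ∣ α.re ^ 2 := by
        have := dvd_add h2 ((hβ.trans (dvd_pow_self _ two_ne_zero)).mul_left (ε : R))
        simpa using this
      have h4 : x ∣ α.re := by
        rw [sq] at h3
        exact (H.dvd_or_dvd h3).elim id id
      refine hv (add_mem (smul_mem_yPow ?_ _) (smul_mem_yPow ?_ _)) <;>
        rw [pow_one, IsUniformizer.gen_dvd_iff] <;> assumption
  · intro c hc
    exact hh.isUnit_mem_quadValues H (h0 ▸ isUnit_one) (h1 ▸ ε.isUnit.neg) h01 hc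

theorem quadValues_of_hasType_one_neg_one [Finite R] [Module.Free (RamExt x) V]
    (hh : IsNondegHermitian h) (H : IsUniformizer x l) (ht : HasType h ![1, -1]) :
    quadValues h = Set.univ := by
  obtain ⟨b, hb⟩ := ht
  have h01 : h (b 0) (b 1) = 0 := by simpa using hb 0 1
  have h0 : quad h (b 0) = 1 := by rw [quad, hb 0 0]; simp [QuadraticAlgebra.re_one]
  have h1 : quad h (b 1) = -1 := by rw [quad, hb 1 1]; simp [QuadraticAlgebra.re_one]
  refine hh.quadValues_eq_univ H (h0 ▸ isUnit_one) (h1 ▸ isUnit_one.neg) h01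
    (w := (1 : RamExt x) • b 0 + (1 : RamExt x) • b 1) ?_ ?_
  · refine notMem_yPow_one_of_isUnit (h := h) H (u := b 0) ?_
    rw [one_smul, one_smul, map_add, h01, add_zero]
    exact H.isUnit_ext_iff.2 (h0 ▸ isUnit_one : IsUnit (quad h (b 0)))
  · rw [hh.quad_smul_add_smul H h01, h0, h1]
    simp

/-- Diagonalize h as {1, c}. If -c is a square there is a primitive isotropic vector; if not, -cε is
a square and rescaling gives the excluded type. -/
theorem quadValues_of_finrank_eq_two [Finite R] [Module.Free (RamExt x) V]
    [Module.Finite (RamExt x) V] (hh : IsNondegHermitian h) (H : IsUniformizer x l)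
    (hrank : Module.finrank (RamExt x) V = 2) {ε : Rˣ} (hε : ¬ IsSquare ε)
    (ht : ¬ HasType h ![1, -ε]) : quadValues h = Set.univ := by
  obtain ⟨u', -, hu'⟩ := hh.exists_orthogonal H (k := 0) Fin.elim0 (fun i => i.elim0)
    (fun i => i.elim0) (by omega)
  have hsing : ∀ u : V, IsUnit (quad h u) → ∃ v, h u v = 0 ∧ IsUnit (quad h v) := by
    intro u hu
    obtain ⟨v, hv, hv'⟩ := hh.exists_orthogonal H (k := 1) ![u]
      (fun i j hij => absurd (Subsingleton.elim i j) hij) (fun i => by simpa using hu) (by omega)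
    exact ⟨v, by simpa using hv 0, hv'⟩
  obtain ⟨v', huv', hv'⟩ := hsing u' hu'
  obtain ⟨u, -, hu⟩ := hh.isUnit_mem_quadValues H hu' hv' huv' isUnit_one
  obtain ⟨v, huv, c, hc⟩ := hsing u (hu ▸ isUnit_one)
  have hv : IsUnit (quad h v) := hc ▸ c.isUnit
  by_cases hsq : IsSquare (-c)
  · obtain ⟨t, ht⟩ := hsq
    have h1 : quad h (algebraMap R (RamExt x) t • u + (1 : RamExt x) • v) = 0 := by
      rw [hh.quad_smul_add_smul H huv, hu, ← hc, norm_eq, map_one]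
      have : (-c : R) = t * t := by exact_mod_cast congrArg Units.val ht
      simp
      linear_combination -this
    refine hh.quadValues_eq_univ H (hu ▸ isUnit_one) hv huv
      (w := algebraMap R (RamExt x) t • u + (1 : RamExt x) • v) ?_ (by rw [h1]; exact dvd_zero x)
    refine notMem_yPow_one_of_isUnit (h := h) H (u := v) ?_
    have hvu : h v u = 0 := by rw [hh.symm u v, huv, star_zero]
    rw [map_add, map_smul, map_smul, hvu, smul_zero, zero_add, one_smul]
    exact H.isUnit_ext_iff.2 hv
  · obtain ⟨t, ht'⟩ := H.isSquare_mul_of_not_isSquare hsq hε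
    have ht2 : (-c * ε : R) = t * t := by exact_mod_cast congrArg Units.val ht'
    refine absurd ?_ ht
    -- Since t² = -cε, the vector (t/c)v has length t²/c = -ε.
    have h1 : quad h ((0 : RamExt x) • u + algebraMap R (RamExt x) (t * (c⁻¹ : Rˣ)) • v) =
        ((-ε : Rˣ) : R) := by
      rw [hh.quad_smul_add_smul H huv, ← hc, norm_eq, norm_eq]
      have hci : (c : R) * (c⁻¹ : Rˣ) = 1 := c.mul_inv
      simp only [QuadraticAlgebra.algebraMap_re, QuadraticAlgebra.algebraMap_im,
        QuadraticAlgebra.re_zero, QuadraticAlgebra.im_zero, Units.val_neg]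
      linear_combination (-(c : R) * (c⁻¹ : Rˣ) ^ 2) * ht2 - ε * ((c : R) * (c⁻¹ : Rˣ) + 1) * hci
    exact hh.hasType_of_orthogonal H hrank (u := u) (a := 1) (by simp [huv]) (by rw [hu, Units.val_one]) h1

/-- For three orthogonal vectors of unit length, the first two combine to a z with h(z, z) ≡ -h(w,
w) mod x, and z + w is primitive because it pairs with w to a unit. -/
theorem quadValues_of_two_lt_finrank [Finite R] [Module.Free (RamExt x) V]
    [Module.Finite (RamExt x) V] (hh : IsNondegHermitian h) (H : IsUniformizer x l)
    (hrank : 2 < Module.finrank (RamExt x) V) : quadValues h = Set.univ := by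
  obtain ⟨u, -, hu⟩ := hh.exists_orthogonal H (k := 0) Fin.elim0 (fun i => i.elim0)
    (fun i => i.elim0) (by omega)
  obtain ⟨v, huv, hv⟩ := hh.exists_orthogonal H (k := 1) ![u]
    (fun i j hij => absurd (Subsingleton.elim i j) hij) (fun i => by simpa using hu) (by omega)
  replace huv : h u v = 0 := by simpa using huv 0
  have hvu : h v u = 0 := by rw [hh.symm u v, huv, star_zero]
  obtain ⟨w, huvw, hw⟩ := hh.exists_orthogonal H (k := 2) ![u, v]
    (fun i j hij => by fin_cases i <;> fin_cases j <;> simp_all)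
    (fun i => by fin_cases i <;> simp [hu, hv]) (by omega)
  have huw : h u w = 0 := by simpa using huvw 0
  have hvw : h v w = 0 := by simpa using huvw 1
  have hwu : h w u = 0 := by rw [hh.symm u w, huw, star_zero]
  have hwv : h w v = 0 := by rw [hh.symm v w, hvw, star_zero]
  obtain ⟨s, t, hst⟩ := hh.exists_dvd_sub_quad H hu hv huv (-quad h w)
  set z := algebraMap R (RamExt x) s • u + algebraMap R (RamExt x) t • v with hz
  have hzw : h z w = 0 := by simp [hz, huw, hvw]
  have hwz : h w z = 0 := by simp [hz, hwu, hwv]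
  refine hh.quadValues_eq_univ H hu hv huv (w := (1 : RamExt x) • z + (1 : RamExt x) • w) ?_ ?_
  · refine notMem_yPow_one_of_isUnit (h := h) H (u := w) ?_
    rw [one_smul, one_smul, map_add, hwz, zero_add]
    exact H.isUnit_ext_iff.2 hw
  · rw [hh.quad_smul_add_smul H hzw, map_one, one_mul, one_mul, ← dvd_neg]
    convert hst using 1
    ring

end IsNondegHermitian

end RamifiedWeil

/-! ### The main theorem. -/

theorem mainTheorem6 {R : Type*} [CommRing R] [Finite R] [IsLocalRing R] [IsPrincipalIdealRing R]
    (hodd : Odd (ringChar R))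
    (x : R) (hx : IsLocalRing.maximalIdeal R = Ideal.span {x})
    (l : ℕ) (hl : IsLeast {k : ℕ | IsLocalRing.maximalIdeal R ^ k = ⊥} l)
    (q : ℕ) (hq : q = Nat.card (IsLocalRing.ResidueField R))
    {V : Type*} [AddCommGroup V] [Module (RamifiedWeil.RamExt x) V]
    [Module.Free (RamifiedWeil.RamExt x) V] [Module.Finite (RamifiedWeil.RamExt x) V]
    (m : ℕ) (hm : 1 ≤ m) (hrank : Module.finrank (RamifiedWeil.RamExt x) V = m)
    (h : V →ₗ⋆[RamifiedWeil.RamExt x] V →ₗ[RamifiedWeil.RamExt x] RamifiedWeil.RamExt x)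
    (hh : RamifiedWeil.IsNondegHermitian h)
    (lam : AddChar R ℂ) (hlam : lam.IsPrimitive)
    (ε : Rˣ) (hε : ¬ IsSquare ε) :
    ∃ L : ℕ,
      RamifiedWeil.numConstituents (RamifiedWeil.top h lam
        (RamifiedWeil.pow_eq_zero_of_nilpotency hx hl)).toRepresentation = L ∧
      RamifiedWeil.lengthOf (RamifiedWeil.top h lam
        (RamifiedWeil.pow_eq_zero_of_nilpotency hx hl)).toRepresentation = (L : ℕ∞) ∧
      L = RamifiedWeil.orbitCount h ∧
      (m = 1 → L = q ^ l - q ^ (l - 1)) ∧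
      (m = 2 → RamifiedWeil.HasType h ![1, -ε] → L = 2 * (q ^ l - q ^ (l - 1))) ∧
      (m = 2 → RamifiedWeil.HasType h ![1, -1] → L = 2 * q ^ l) ∧
      (m ≠ 1 → ¬ (m = 2 ∧ RamifiedWeil.HasType h ![1, -ε]) → L = 2 * q ^ l) := by

  have H := RamifiedWeil.isUniformizer_of_isLocalRing hodd hx hl
  have : Finite (RamifiedWeil.RamExt x) := RamifiedWeil.finite_ramExt
  have : Finite V := Module.finite_of_finite (RamifiedWeil.RamExt x)
  obtain ⟨hnum, hlen⟩ := RamifiedWeil.numConstituents_and_length_top hh H hlam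
  rw [RamifiedWeil.card_classes hh H] at hnum hlen
  have hq' : q = Nat.card (R ⧸ Ideal.span {x}) := by
    rw [hq, ← hx]
    rfl
  have hunit := H.card_isUnit
  have huniv : RamifiedWeil.quadValues h = Set.univ → Nat.card (RamifiedWeil.quadValues h) =
      q ^ l := by
    intro h1
    rw [h1, Nat.card_congr (Equiv.Set.univ R), H.card_eq_pow, hq']
  rw [← hq'] at hunit
  refine ⟨2 * Nat.card (RamifiedWeil.quadValues h), hnum, hlen,
    (RamifiedWeil.orbitCount_eq hh H).symm, ?_, ?_, ?_, ?_⟩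
  · rintro rfl
    rw [hh.card_quadValues_of_finrank_eq_one H hrank, hunit]
  · intro _ ht
    rw [hh.quadValues_of_hasType_neg_nonsquare H hε ht, hunit]
  · intro _ ht
    rw [huniv (hh.quadValues_of_hasType_one_neg_one H ht)]
  · intro h1 h2
    rcases (show m = 2 ∨ 2 < m by omega) with rfl | h3
    · rw [huniv (hh.quadValues_of_finrank_eq_two H hrank hε fun ht => h2 ⟨rfl, ht⟩)]
    · rw [huniv (hh.quadValues_of_two_lt_finrank H (hrank ▸ h3))]
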